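/- All theories are many-sorted and first-order; "definable" means definable without parameters, and elements of finite products of sorts count as elements of a model. For a set $A$ of elements of a structure $M$, $\mathrm{dcl}(A)$ is the set of all $b$ such that $\{b\}$ is defined by a formula with parameters from $A$; $A$ is definably closed if $\mathrm{dcl}(A)=A$. An interpretation $i$ of a theory $T_0$ in a theory $T$ assigns to the sorts, relations and functions of $T_0$ definable sets, relations and functions of $T$, so that every model $M$ of $T$ carries a model $M_0$ of $T_0$, viewed as a subset of $M$. It is stably embedded if for every definable family $Z\subseteq X\times i(Y_0)$ of $T$ there is a definable family $Z_0\subseteq W_0\times Y_0$ of $T_0$ such that, in every model of $T$, each fibre $Z_x$ equals $i(Z_0)_w$ for some $w\in i(W_0)$. A stably embedded interpretation $i$ makes $T$ an internal cover of $T_0$ if there is a stably embedded interpretation $\pi$ of $T$ in $T_0$ such that $\pi\circ i$ is the identity (up to isomorphism definable without parameters). **Proposition.** Let $T$ be an internal cover of $T_0$, where $T_0$ eliminates imaginaries. Let $G$ be the Galois pro-group of the cover, that is, a pro-group in $T$ (an inverse system of definable groups $G_k$ and definable homomorphisms over a directed set, $G(M)=\varprojlim_k G_k(M)$), with a definable action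 on every definable set of $T$, through which $G(M)$ is identified with $\mathrm{Aut}(M/M_0)$ for every model $M$ of $T$. Let $M$ be a model of $T$ and let $A\subseteq M$ be a set of internality parameters, that is, $A$ is definably closed and $\mathrm{dcl}(N_0\cup A)=N$ for every model $N$ of the theory of $M$ with constants for $A$. Let $A_0=A\cap M_0$. Let $B_0\subseteq M_0$ contain $A_0$ and be definably closed in the $T_0$-structure $M_0$, and let $B=\mathrm{dcl}(A\cup B_0)$, computed in $M$. Let $G(B)$ be the set of $g\in G(M)$ all of whose coordinates $g_k\in G_k(M)$ lie in $B$, and let $\mathrm{Aut}(B/B_0)$ be the group of (sort-preserving) permutations $\sigma$ of $B$ that fix $B_0$ pointwise and satisfy $x\in Q(M)\iff\sigma(x)\in Q(M)$ for every definable set $Q$ and every tuple $x$ from $B$. Then $G(B)$ is a subgroup of $G(M)$, and $G(B)=\mathrm{Aut}(B/B_0)$: the action of $G$ restricts to $B$ and gives an isomorphism of groups from $G(B)$ onto $\mathrm{Aut}(B/B_0)$. -/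

import Mathlib

universe u v w

namespace ManySorted

/-- A many-sorted first-order language. -/
structure Lang where
  Sorts : Type u
  Fun : List Sorts → Sorts → Type u
  Rel : List Sorts → Type u

/-- Elements of the product of the sorts `Γ i`. -/
abbrev Tuple {S : Type u} {ι : Type w} (M : S → Type v) (Γ : ι → S) : Type (max v w) :=
  ∀ i, M (Γ i)

/-- Concatenation of tuples. -/
def pair {S : Type u} {ι κ : Type*} {M : S → Type v} {Γ : ι → S} {Δ : κ → S}
    (x : Tuple M Γ) (y : Tuple M Δ) : Tuple M (Sum.elim Γ Δ)
  | Sum.inl i => x i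
  | Sum.inr j => y j

/-- Terms whose free variables are the `a : α` (of sort `Γ a`) and whose bound variables have
the sorts listed in `Δ`. -/
inductive Term (L : Lang.{u}) {α : Type w} (Γ : α → L.Sorts) (Δ : List L.Sorts) :
    L.Sorts → Type (max u w)
  | free (a : α) : Term L Γ Δ (Γ a)
  | bound (k : Fin Δ.length) : Term L Γ Δ (Δ.get k)
  | app {a : List L.Sorts} {s : L.Sorts} (f : L.Fun a s)
      (ts : ∀ k : Fin a.length, Term L Γ Δ (a.get k)) : Term L Γ Δ s

/-- First-order formulas; `all` binds a new variable, placed in front of the list `Δ`. -/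
inductive BForm (L : Lang.{u}) {α : Type w} (Γ : α → L.Sorts) : List L.Sorts → Type (max u w)
  | falsum {Δ : List L.Sorts} : BForm L Γ Δ
  | eq {Δ : List L.Sorts} {s : L.Sorts} (t₁ t₂ : Term L Γ Δ s) : BForm L Γ Δ
  | rel {Δ : List L.Sorts} {a : List L.Sorts} (R : L.Rel a)
      (ts : ∀ k : Fin a.length, Term L Γ Δ (a.get k)) : BForm L Γ Δ
  | imp {Δ : List L.Sorts} (φ ψ : BForm L Γ Δ) : BForm L Γ Δ
  | all {Δ : List L.Sorts} (s : L.Sorts) (φ : BForm L Γ (s :: Δ)) : BForm L Γ Δ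

/-- Formulas with free variables `a : α`, the variable `a` being of sort `Γ a`. -/
abbrev Formula (L : Lang.{u}) {α : Type w} (Γ : α → L.Sorts) : Type (max u w) := BForm L Γ []

/-- An `L`-structure (sorts may be empty). -/
structure Struc (L : Lang.{u}) where
  carrier : L.Sorts → Type u
  funMap : ∀ {a : List L.Sorts} {s : L.Sorts}, L.Fun a s → Tuple carrier a.get → carrier s
  relMap : ∀ {a : List L.Sorts}, L.Rel a → Tuple carrier a.get → Prop

instance (L : Lang.{u}) : CoeFun (Struc L) (fun _ => L.Sorts → Type u) := ⟨Struc.carrier⟩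

/-- The value of a term. -/
def Term.val {L : Lang.{u}} (M : Struc L) {α : Type w} {Γ : α → L.Sorts} {Δ : List L.Sorts}
    (x : Tuple M Γ) (e : Tuple M Δ.get) : ∀ {s : L.Sorts}, Term L Γ Δ s → M s
  | _, .free a => x a
  | _, .bound k => e k
  | _, .app f ts => M.funMap f (fun k => (ts k).val M x e)

/-- Extension of an assignment of the bound variables. -/
def consTuple {S : Type u} {M : S → Type v} {s : S} {Δ : List S} (b : M s)
    (e : Tuple M Δ.get) : Tuple M (s :: Δ).get
  | ⟨0, _⟩ => b
  | ⟨k + 1, h⟩ => e ⟨k, Nat.lt_of_succ_lt_succ h⟩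

/-- Truth of a formula under an assignment. -/
def BForm.Holds {L : Lang.{u}} (M : Struc L) {α : Type w} {Γ : α → L.Sorts} (x : Tuple M Γ) :
    ∀ {Δ : List L.Sorts}, BForm L Γ Δ → Tuple M Δ.get → Prop
  | _, .falsum, _ => False
  | _, .eq t₁ t₂, e => t₁.val M x e = t₂.val M x e
  | _, .rel R ts, e => M.relMap R (fun k => (ts k).val M x e)
  | _, .imp φ ψ, e => φ.Holds M x e → ψ.Holds M x e
  | _, .all s φ, e => ∀ b : M s, φ.Holds M x (consTuple b e)

/-- `φ(x)` is true in `M`. -/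
def Formula.Realize {L : Lang.{u}} {α : Type w} {Γ : α → L.Sorts} (φ : Formula L Γ)
    (M : Struc L) (x : Tuple M Γ) : Prop :=
  BForm.Holds M x φ (fun k => k.elim0)

/-- Sentences: formulas without free variables. -/
abbrev Sentence (L : Lang.{u}) : Type u := Formula L (fun a : Empty => (a.elim : L.Sorts))

/-- A theory is a set of sentences. -/
abbrev Theory (L : Lang.{u}) : Type u := Set (Sentence L)

/-- All sentences of `T` are true in `M`. -/
def Theory.IsModel {L : Lang.{u}} (T : Theory L) (M : Struc L) : Prop :=
  ∀ φ ∈ T, Formula.Realize φ M (fun a => a.elim)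

/-- Models of `T`. -/
structure Model {L : Lang.{u}} (T : Theory L) extends Struc L where
  isModel : T.IsModel toStruc

/-- A definable set (without parameters), inside a finite product of sorts. -/
structure DefSet (L : Lang.{u}) where
  ι : Type
  [fin : Finite ι]
  sort : ι → L.Sorts
  form : Formula L sort

/-- The set `X(M)`. -/
abbrev DefSet.pts {L : Lang.{u}} (X : DefSet L) (M : Struc L) : Type u :=
  {x : Tuple M X.sort // X.form.Realize M x}

/-- `T` eliminates imaginaries: every definable equivalence relation `E` on a definable set `X`
has the form `f x = f y` for a definable function `f` (with graph `F`) on `X`. -/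
def Theory.ElimImaginaries {L : Lang.{u}} (T : Theory L) : Prop :=
  ∀ (X : DefSet L) (E : Formula L (Sum.elim X.sort X.sort)),
    (∀ M : Model T, Equivalence
      (fun x y : X.pts M.toStruc => E.Realize M.toStruc (pair x.1 y.1))) →
    ∃ (κ : Type) (_ : Finite κ) (Γ : κ → L.Sorts) (F : Formula L (Sum.elim X.sort Γ)),
      ∀ M : Model T, ∃ f : X.pts M.toStruc → Tuple M.toStruc Γ,
        (∀ x y, f x = y ↔ F.Realize M.toStruc (pair x.1 y)) ∧
        ∀ x y, E.Realize M.toStruc (pair x.1 y.1) ↔ f x = f y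

/-! ### Definable closure and automorphisms -/

/-- A family of subsets of the sorts of a structure, that is, a set of its elements. -/
abbrev Subsets {L : Lang.{u}} (M : Struc L) : Type u := ∀ s, Set (M s)

/-- The definable closure: `b ∈ dcl M A` if `{b}` is defined by a formula with parameters
from `A`. -/
def dcl {L : Lang.{u}} (M : Struc L) (A : Subsets M) : Subsets M := fun s =>
  {b | ∃ φ : Formula L (Sum.elim (fun a : (Σ t, A t) => a.1) (fun _ : Unit => s)),
    ∀ y : M s, φ.Realize M (pair (fun a : (Σ t, A t) => a.2.1) (fun _ => y)) ↔ y = b}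

/-- `A` is definably closed. -/
def IsDefClosed {L : Lang.{u}} (M : Struc L) (A : Subsets M) : Prop := dcl M A ≤ A

/-- `Aut(B/F)`: the sortwise permutations of `B` that preserve all definable sets (as
computed in `M`) and fix the elements of `B` that lie in `F`. -/
def autGroup {L : Lang.{u}} (M : Struc L) (B F : Subsets M) :
    Subgroup (∀ s, Equiv.Perm (B s)) where
  carrier := {σ |
    (∀ (Q : DefSet L) (x : ∀ j, B (Q.sort j)),
      Q.form.Realize M (fun j => (x j).1) ↔ Q.form.Realize M (fun j => (σ _ (x j)).1)) ∧
    ∀ s (b : B s), b.1 ∈ F s → σ s b = b}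
  one_mem' := ⟨fun _ _ => Iff.rfl, fun _ _ _ => rfl⟩
  mul_mem' := by
    rintro σ τ ⟨h1, h2⟩ ⟨k1, k2⟩
    refine ⟨fun Q x => (k1 Q x).trans (h1 Q (fun j => τ _ (x j))), fun s b hb => ?_⟩
    change σ s (τ s b) = b
    rw [k2 s b hb, h2 s b hb]
  inv_mem' := by
    rintro σ ⟨h1, h2⟩
    refine ⟨fun Q x => ?_, fun s b hb => ?_⟩
    · have h := h1 Q (fun j => (σ _)⁻¹ (x j))
      have hx : (fun j => (σ (Q.sort j) ((σ _)⁻¹ (x j))).1) = fun j => (x j).1 :=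
        funext fun j => congrArg Subtype.val ((σ (Q.sort j)).apply_symm_apply (x j))
      rw [hx] at h
      exact h.symm
    · change (σ s)⁻¹ b = b
      rw [Equiv.Perm.inv_eq_iff_eq]
      exact (h2 s b hb).symm

/-- A map `j` from a set `A` of elements of `M` to `N` is elementary if it preserves the truth
of all formulas. This makes `N` a model of the theory of `M` with constants for `A`. -/
def IsElementary {L : Lang.{u}} (M N : Struc L) (A : Subsets M) (j : ∀ s, A s → N s) : Prop :=
  ∀ (Q : DefSet L) (x : ∀ k, A (Q.sort k)),
    Q.form.Realize M (fun k => (x k).1) ↔ Q.form.Realize N (fun k => j _ (x k))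

/-! ### Interpretations -/

/-- If each sort `s` of `L₀` is sent to the definable set `obj s`, these are the sorts of `L`
in which the product of the sets `obj (Γ k)` lies. -/
def flatSort {L₀ L : Lang.{u}} (obj : L₀.Sorts → DefSet L) {κ : Type w} (Γ : κ → L₀.Sorts) :
    (Σ k, (obj (Γ k)).ι) → L.Sorts :=
  fun p => (obj (Γ p.1)).sort p.2

/-- A tuple of elements of the sets `obj (Γ k)`, as a tuple of elements of sorts of `L`. -/
def flatten {L₀ L : Lang.{u}} {obj : L₀.Sorts → DefSet L} {M : Struc L} {κ : Type w}
    {Γ : κ → L₀.Sorts} (x : ∀ k, (obj (Γ k)).pts M) : Tuple M (flatSort obj Γ) :=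
  fun p => (x p.1).1 p.2

/-- The data of an interpretation of the language `L₀` in the theory `T`: a definable set for
each sort, a definable relation for each relation symbol, and a definable function for each
function symbol. -/
structure PreInterp (L₀ : Lang.{u}) {L : Lang.{u}} (T : Theory L) where
  obj : L₀.Sorts → DefSet L
  rel : ∀ {a : List L₀.Sorts}, L₀.Rel a → Formula L (flatSort obj a.get)
  graph : ∀ {a : List L₀.Sorts} {s : L₀.Sorts}, L₀.Fun a s →
    Formula L (Sum.elim (flatSort obj a.get) (obj s).sort)
  graph_total : ∀ (M : Model T) {a : List L₀.Sorts} {s : L₀.Sorts} (f : L₀.Fun a s)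
    (x : ∀ k, (obj (a.get k)).pts M.toStruc),
    ∃! y : (obj s).pts M.toStruc, (graph f).Realize M.toStruc (pair (flatten x) y.1)

/-- The `L₀`-structure `M₀` carried by a model `M` of `T`. -/
noncomputable def PreInterp.struc {L₀ L : Lang.{u}} {T : Theory L} (i : PreInterp L₀ T)
    (M : Model T) : Struc L₀ where
  carrier s := (i.obj s).pts M.toStruc
  funMap f x := (i.graph_total M f x).choose
  relMap R x := (i.rel R).Realize M.toStruc (flatten x)

/-- An interpretation of `T₀` in `T`. -/
structure Interp {L₀ L : Lang.{u}} (T₀ : Theory L₀) (T : Theory L) extends PreInterp L₀ T where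
  isModel : ∀ M : Model T, T₀.IsModel (toPreInterp.struc M)

/-- The model `M₀` of `T₀` carried by a model `M` of `T`. -/
noncomputable def Interp.res {L₀ L : Lang.{u}} {T₀ : Theory L₀} {T : Theory L}
    (i : Interp T₀ T) (M : Model T) : Model T₀ :=
  ⟨i.toPreInterp.struc M, i.isModel M⟩

/-- `i` is stably embedded: for every definable family `Z` (with parameters `x` in a product of
sorts of `T`) of subsets of a product of sorts of `T₀`, there is a definable family `Z₀` in `T₀`
such that in each model of `T` every `Z_x` is some `(Z₀)_w`. -/
def Interp.StablyEmbedded {L₀ L : Lang.{u}} {T₀ : Theory L₀} {T : Theory L}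
    (i : Interp T₀ T) : Prop :=
  ∀ (ι κ : Type) [Finite ι] [Finite κ] (Γ : ι → L.Sorts) (Γ₀ : κ → L₀.Sorts)
    (Z : Formula L (Sum.elim Γ (flatSort i.obj Γ₀))),
    ∃ (ν : Type) (_ : Finite ν) (Δ₀ : ν → L₀.Sorts) (Z₀ : Formula L₀ (Sum.elim Δ₀ Γ₀)),
      ∀ (M : Model T) (x : Tuple M.toStruc Γ), ∃ w : Tuple (i.res M).toStruc Δ₀,
        ∀ y : Tuple (i.res M).toStruc Γ₀,
          Z.Realize M.toStruc (pair x (flatten y)) ↔ Z₀.Realize (i.res M).toStruc (pair w y)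

/-- `π ∘ i` is the identity: there are bijections of `s` with `π (i s)`, for the sorts `s` of
`T₀`, definable in `T₀` without parameters (by the formulas `η s`), that form an isomorphism
from each model `N` of `T₀` to the model of `T₀` obtained from `N` through `π ∘ i`. -/
def Interp.CompIsId {L₀ L : Lang.{u}} {T₀ : Theory L₀} {T : Theory L}
    (π : Interp T T₀) (i : Interp T₀ T) : Prop :=
  ∃ η : ∀ s : L₀.Sorts,
      Formula L₀ (Sum.elim (fun _ : Unit => s) (flatSort π.obj (i.obj s).sort)),
    ∀ N : Model T₀, ∃ h : ∀ s, N.carrier s ≃ (i.res (π.res N)).carrier s,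
      (∀ s x y, h s x = y ↔ (η s).Realize N.toStruc
        (pair (fun _ => x) (flatten (obj := π.obj) (Γ := (i.obj s).sort) y.1))) ∧
      (∀ (a : List L₀.Sorts) (s : L₀.Sorts) (f : L₀.Fun a s) (x : Tuple N.toStruc a.get),
        h s (N.funMap f x) = (i.res (π.res N)).funMap f (fun k => h _ (x k))) ∧
      ∀ (a : List L₀.Sorts) (R : L₀.Rel a) (x : Tuple N.toStruc a.get),
        N.relMap R x ↔ (i.res (π.res N)).relMap R (fun k => h _ (x k))

/-- `i` makes `T` an internal cover of `T₀`. -/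
def Interp.IsInternalCover {L₀ L : Lang.{u}} {T₀ : Theory L₀} {T : Theory L}
    (i : Interp T₀ T) : Prop :=
  i.StablyEmbedded ∧ ∃ π : Interp T T₀, π.StablyEmbedded ∧ π.CompIsId i

/-- A set `B₀` of elements of `M₀`, seen in `M`. An element of `M₀` is a tuple of elements of
`M`, and is replaced by its components. -/
def Interp.inj {L₀ L : Lang.{u}} {T₀ : Theory L₀} {T : Theory L} (i : Interp T₀ T) (M : Model T)
    (B₀ : Subsets (i.res M).toStruc) : Subsets M.toStruc := fun s =>
  {b | ∃ (s₀ : L₀.Sorts) (x : (i.obj s₀).pts M.toStruc), x ∈ B₀ s₀ ∧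
    ∃ j, (⟨(i.obj s₀).sort j, x.1 j⟩ : Σ t, M.carrier t) = ⟨s, b⟩}

/-- `A₀`: the elements of `M₀` that lie in `A` (all of whose components lie in `A`). -/
def Interp.restrict {L₀ L : Lang.{u}} {T₀ : Theory L₀} {T : Theory L} (i : Interp T₀ T)
    (M : Model T) (A : Subsets M.toStruc) : Subsets (i.res M).toStruc := fun s₀ =>
  {x : (i.obj s₀).pts M.toStruc | ∀ j, x.1 j ∈ A ((i.obj s₀).sort j)}

/-- `A ⊆ M` is a set of internality parameters: it is definably closed, and
`dcl(N₀ ∪ A) = N` for every model `N` of `T` that contains `A` (as a model of the theory of `M`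
with constants for `A`). -/
def Interp.IsInternalityParams {L₀ L : Lang.{u}} {T₀ : Theory L₀} {T : Theory L}
    (i : Interp T₀ T) (M : Model T) (A : Subsets M.toStruc) : Prop :=
  IsDefClosed M.toStruc A ∧
  ∀ (N : Model T) (j : ∀ s, A s → N.carrier s), IsElementary M.toStruc N.toStruc A j →
    ∀ s, dcl N.toStruc (fun t => i.inj N (fun _ => Set.univ) t ∪ Set.range (j t)) s = Set.univ

/-! ### Pro-groups -/

/-- A definable group in `T`: a definable set, with a group structure on its points in each
model of `T`, whose multiplication is given by one formula. -/
structure DefGroup {L : Lang.{u}} (T : Theory L) extends DefSet L where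
  group : ∀ M : Model T, Group (toDefSet.pts M.toStruc)
  mul_def : ∃ μ : Formula L (Sum.elim (Sum.elim sort sort) sort),
    ∀ (M : Model T) (x y z : toDefSet.pts M.toStruc),
      (group M).mul x y = z ↔ μ.Realize M.toStruc (pair (pair x.1 y.1) z.1)

/-- The group `G(M)`. -/
def DefGroup.pts {L : Lang.{u}} {T : Theory L} (G : DefGroup T) (M : Model T) : Type u :=
  G.toDefSet.pts M.toStruc

instance {L : Lang.{u}} {T : Theory L} (G : DefGroup T) (M : Model T) : Group (G.pts M) :=
  G.group M

/-- A pro-group in `T`: an inverse system, over a directed set, of definable groups and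
definable homomorphisms. -/
structure ProGroup {L : Lang.{u}} (T : Theory L) where
  I : Type u
  [preorder : Preorder I]
  [nonempty : Nonempty I]
  directed : ∀ i j : I, ∃ k, i ≤ k ∧ j ≤ k
  grp : I → DefGroup T
  map : ∀ {i j : I}, i ≤ j → ∀ M : Model T, (grp j).pts M →* (grp i).pts M
  map_def : ∀ {i j : I} (h : i ≤ j), ∃ φ : Formula L (Sum.elim (grp j).sort (grp i).sort),
    ∀ (M : Model T) (x : (grp j).pts M) (y : (grp i).pts M),
      map h M x = y ↔ φ.Realize M.toStruc (pair x.1 y.1)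
  map_id : ∀ (i : I) (M : Model T) (x : (grp i).pts M), map le_rfl M x = x
  map_comp : ∀ {i j k : I} (h : i ≤ j) (h' : j ≤ k) (M : Model T) (x : (grp k).pts M),
    map h M (map h' M x) = map (h.trans h') M x

attribute [instance] ProGroup.preorder ProGroup.nonempty

/-- The group `G(M)`, the inverse limit of the groups `Gᵢ(M)`. -/
def ProGroup.pts {L : Lang.{u}} {T : Theory L} (G : ProGroup T) (M : Model T) :
    Subgroup (∀ i, (G.grp i).pts M) where
  carrier := {g | ∀ (i j : G.I) (h : i ≤ j), G.map h M (g j) = g i}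
  one_mem' := fun i j h => map_one (G.map h M)
  mul_mem' := by
    intro a b ha hb i j h
    rw [Pi.mul_apply, map_mul, ha i j h, hb i j h, Pi.mul_apply]
  inv_mem' := by
    intro a ha i j h
    rw [Pi.inv_apply, map_inv, ha i j h, Pi.inv_apply]

/-- A definable action of a pro-group on every definable set `Q`: the action on `Q` is a
definable action of one of the groups of the system, `G (idx Q)`. -/
structure ProGroup.Action {L : Lang.{u}} {T : Theory L} (G : ProGroup T) where
  idx : DefSet L → G.I
  act : ∀ (Q : DefSet L) (M : Model T), MulAction ((G.grp (idx Q)).pts M) (Q.pts M.toStruc)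
  act_def : ∀ Q : DefSet L,
    ∃ φ : Formula L (Sum.elim (Sum.elim (G.grp (idx Q)).sort Q.sort) Q.sort),
      ∀ (M : Model T) (g : (G.grp (idx Q)).pts M) (x y : Q.pts M.toStruc),
        (act Q M).smul g x = y ↔ φ.Realize M.toStruc (pair (pair g.1 x.1) y.1)

/-- The action of `g ∈ G(M)` on `Q(M)`. -/
def ProGroup.Action.apply {L : Lang.{u}} {T : Theory L} {G : ProGroup T} (m : G.Action)
    {M : Model T} (g : G.pts M) (Q : DefSet L) (x : Q.pts M.toStruc) : Q.pts M.toStruc :=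
  (m.act Q M).smul (g.1 (m.idx Q)) x

/-- `G(B) = Aut(B/F)` through the action: the `g ∈ G(M)` whose coordinates `gᵢ ∈ Gᵢ(M)` lie
in `B` form a group, and there is an isomorphism from this group to `Aut(B/F)` under which `g`
corresponds to the automorphism of `B` (acting on tuples componentwise) induced by the action
of `g` on each `Q(M)`. -/
def ProGroup.Action.IdentifiesWithAut {L : Lang.{u}} {T : Theory L} {G : ProGroup T}
    (m : G.Action) (M : Model T) (B F : Subsets M.toStruc) : Prop :=
  ∃ GB : Subgroup (G.pts M),
    (∀ g : G.pts M, g ∈ GB ↔ ∀ i j, (g.1 i).1 j ∈ B ((G.grp i).sort j)) ∧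
    ∃ e : GB ≃* autGroup M.toStruc B F,
      ∀ (g : GB) (Q : DefSet L) (x : Q.pts M.toStruc) (hx : ∀ j, x.1 j ∈ B (Q.sort j)) (j : Q.ι),
        (m.apply g.1 Q x).1 j = ((e g).1 (Q.sort j) ⟨x.1 j, hx j⟩).1

/-- `G`, with the action `m`, is the Galois pro-group of the cover: `G(M) = Aut(M/M₀)`, through
the action, for every model `M` of `T`. -/
def ProGroup.Action.IsGalois {L₀ L : Lang.{u}} {T₀ : Theory L₀} {T : Theory L} {G : ProGroup T}
    (m : G.Action) (i : Interp T₀ T) : Prop :=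
  ∀ M : Model T, m.IdentifiesWithAut M (fun _ => Set.univ) (i.inj M (fun _ => Set.univ))

end ManySorted

-- An automorphism of `M` over `M₀` is determined by its values on `A`, since `dcl(M₀ ∪ A) = M`. As
-- `A ⊆ B`, restriction to `B` is therefore injective on `G(B)`. It maps `B` to itself because the
-- action is definable without parameters and `B` is definably closed.
--
-- For surjectivity let `σ ∈ Aut(B/B₀)`. Given a formula `φ(x, y)` with `y` ranging over `M₀` and a
-- tuple `a` from `A`, stable embeddedness makes `φ(a, ·)` definable in `M₀`, and elimination of
-- imaginaries gives it a canonical parameter there. That parameter is definable from `a`, so it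
-- lies in `A₀ ⊆ B₀` and `σ` fixes it. Hence `φ(a, ·)` and `φ(σ a, ·)` coincide
-- (`Interp.StablyEmbedded.realize_iff`). So `(A, M₀)` and `(σ A, M₀)` have the same type. Both
-- generate `M`, the second because internality also applies to the elementary map `σ|A : A → M`. So
-- `σ|A` extends to an automorphism of `M` over `M₀` (`Interp.IsInternalityParams.exists_isAut`),
-- which is the action of some `g ∈ G(M)`.
--
-- It remains to see that `g ∈ G(B)` (`Interp.IsInternalityParams.mem_of_forall_mem`). If some `g_k`
-- is not in `B`, then finitely many conditions `x a = g a` with `a ∈ A`, whose parameters lie in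
-- the definably closed set `B`, never determine `g_k`. By compactness, in the form of an ultrapower
-- `N` of `M`, some `h ∈ G(N)` agrees with `g` on `A` while `h_k ≠ g_k`. But `h` and `g` then agree
-- on `dcl(N₀ ∪ A) = N`, so `h = g`, a contradiction. Finally `g` and `σ` agree on `A ∪ B₀`, hence
-- on its definable closure `B`.

universe w'

namespace ManySorted

variable {L : Lang.{u}}

/-! ### Substitution -/

/-- Weakening by a new bound variable. -/
def Term.shift {α : Type w} {Γ : α → L.Sorts} {Δ : List L.Sorts} (s : L.Sorts) :
    ∀ {t : L.Sorts}, Term L Γ Δ t → Term L Γ (s :: Δ) t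
  | _, .free a => .free a
  | _, .bound k => .bound (Δ := s :: Δ) k.succ
  | _, .app f ts => .app f (fun k => (ts k).shift s)

/-- Simultaneous substitution of terms for free and bound variables. -/
def Term.subst {α : Type w} {β : Type w'} {Γ : α → L.Sorts} {Δ : List L.Sorts}
    {Γ' : β → L.Sorts} {Δ' : List L.Sorts} (ρ : ∀ a, Term L Γ' Δ' (Γ a))
    (τ : ∀ k, Term L Γ' Δ' (Δ.get k)) : ∀ {t : L.Sorts}, Term L Γ Δ t → Term L Γ' Δ' t
  | _, .free a => ρ a
  | _, .bound k => τ k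
  | _, .app f ts => .app f (fun k => (ts k).subst ρ τ)

/-- The substitution of bound variables under a quantifier. -/
def Term.liftBound {β : Type w'} {Δ : List L.Sorts} {Γ' : β → L.Sorts} {Δ' : List L.Sorts}
    (τ : ∀ k, Term L Γ' Δ' (Δ.get k)) (s : L.Sorts) :
    ∀ k, Term L Γ' (s :: Δ') ((s :: Δ).get k)
  | ⟨0, _⟩ => .bound (Δ := s :: Δ') ⟨0, Nat.succ_pos _⟩
  | ⟨k + 1, h⟩ => (τ ⟨k, Nat.lt_of_succ_lt_succ h⟩).shift s

/-- Simultaneous substitution in a formula. -/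
def BForm.subst {α : Type w} {β : Type w'} {Γ : α → L.Sorts} {Γ' : β → L.Sorts} :
    ∀ {Δ Δ' : List L.Sorts} (_ : ∀ a, Term L Γ' Δ' (Γ a)) (_ : ∀ k, Term L Γ' Δ' (Δ.get k)),
      BForm L Γ Δ → BForm L Γ' Δ'
  | _, _, _, _, .falsum => .falsum
  | _, _, ρ, τ, .eq t₁ t₂ => .eq (t₁.subst ρ τ) (t₂.subst ρ τ)
  | _, _, ρ, τ, .rel R ts => .rel R (fun k => (ts k).subst ρ τ)
  | _, _, ρ, τ, .imp φ ψ => .imp (φ.subst ρ τ) (ψ.subst ρ τ)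
  | _, _, ρ, τ, .all s φ => .all s (φ.subst (fun a => (ρ a).shift s) (Term.liftBound τ s))

theorem Term.val_shift (M : Struc L) {α : Type w} {Γ : α → L.Sorts} {Δ : List L.Sorts}
    {s : L.Sorts} (x : Tuple M Γ) (e : Tuple M Δ.get) (b : M s) {t : L.Sorts}
    (r : Term L Γ Δ t) : (r.shift s).val M x (consTuple b e) = r.val M x e := by
  induction r with
  | free a => rfl
  | bound k => rfl
  | app f ts ih => exact congrArg (M.funMap f) (funext fun k => ih k)

theorem Term.val_subst (M : Struc L) {α : Type w} {β : Type w'} {Γ : α → L.Sorts}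
    {Δ : List L.Sorts} {Γ' : β → L.Sorts} {Δ' : List L.Sorts}
    (ρ : ∀ a, Term L Γ' Δ' (Γ a)) (τ : ∀ k, Term L Γ' Δ' (Δ.get k))
    (x : Tuple M Γ') (e : Tuple M Δ'.get) {t : L.Sorts} (r : Term L Γ Δ t) :
    (r.subst ρ τ).val M x e =
      r.val M (fun a => (ρ a).val M x e) (fun k => (τ k).val M x e) := by
  induction r with
  | free a => rfl
  | bound k => rfl
  | app f ts ih => exact congrArg (M.funMap f) (funext fun k => ih k)

theorem Term.val_liftBound (M : Struc L) {β : Type w'} {Δ : List L.Sorts} {Γ' : β → L.Sorts}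
    {Δ' : List L.Sorts} (τ : ∀ k, Term L Γ' Δ' (Δ.get k)) {s : L.Sorts}
    (x : Tuple M Γ') (e : Tuple M Δ'.get) (b : M s) :
    (fun k => (Term.liftBound τ s k).val M x (consTuple b e)) =
      consTuple b (fun k => (τ k).val M x e) := by
  funext k
  rcases k with ⟨_ | k, h⟩
  · rfl
  · exact Term.val_shift M x e b _

theorem BForm.holds_subst (M : Struc L) {α : Type w} {β : Type w'} {Γ : α → L.Sorts}
    {Δ : List L.Sorts} {Γ' : β → L.Sorts} (φ : BForm L Γ Δ) :
    ∀ {Δ' : List L.Sorts} (ρ : ∀ a, Term L Γ' Δ' (Γ a)) (τ : ∀ k, Term L Γ' Δ' (Δ.get k))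
      (x : Tuple M Γ') (e : Tuple M Δ'.get), (φ.subst ρ τ).Holds M x e ↔
        φ.Holds M (fun a => (ρ a).val M x e) (fun k => (τ k).val M x e) := by
  induction φ with
  | falsum => intros; rfl
  | eq t₁ t₂ =>
    intro _ ρ τ x e
    simp only [BForm.subst, BForm.Holds, Term.val_subst]
  | rel R ts =>
    intro _ ρ τ x e
    simp only [BForm.subst, BForm.Holds, Term.val_subst]
  | imp φ ψ ih1 ih2 =>
    intro _ ρ τ x e
    simp only [BForm.subst, BForm.Holds, ih1, ih2]
  | all s φ ih =>
    intro _ ρ τ x e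
    simp only [BForm.subst, BForm.Holds, ih, Term.val_liftBound, Term.val_shift]

/-- The empty family. -/
def nilPi {S : Type u} {F : S → Sort v} (k : Fin ([] : List S).length) : F (([] : List S).get k) :=
  Fin.elim0 k

/-- `Formula.Realize` uses one particular empty assignment of the bound variables; substitution and
ultrapowers may produce others. This brings them all to one form. -/
theorem eq_nilPi {S : Type u} {F : S → Sort v}
    (e : ∀ k : Fin ([] : List S).length, F (([] : List S).get k)) : e = nilPi :=
  funext fun k => Fin.elim0 k

/-- The substitution of terms for the variables of a context. -/
abbrev Sub (L : Lang.{u}) {β : Type w'} (Γ' : β → L.Sorts) {α : Type w} (Γ : α → L.Sorts) :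
    Type (max u w w') :=
  ∀ a, Term L Γ' [] (Γ a)

namespace Sub

variable {α : Type*} {β : Type*} {γ : Type*} {Γ : α → L.Sorts} {Δ : β → L.Sorts}
  {Θ : γ → L.Sorts}

/-- The tuple of values of a substitution. -/
def eval (M : Struc L) (ρ : Sub L Γ Δ) (x : Tuple M Γ) : Tuple M Δ :=
  fun b => (ρ b).val M x nilPi

/-- The projection to the first component. -/
def fst : Sub L (Sum.elim Γ Δ) Γ := fun a => .free (Γ := Sum.elim Γ Δ) (Sum.inl a)

/-- The projection to the second component. -/
def snd : Sub L (Sum.elim Γ Δ) Δ := fun a => .free (Γ := Sum.elim Γ Δ) (Sum.inr a)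

/-- The identity. -/
def id : Sub L Γ Γ := fun a => .free a

/-- The pair of two substitutions. -/
def pair (ρ : Sub L Θ Γ) (τ : Sub L Θ Δ) : Sub L Θ (Sum.elim Γ Δ)
  | Sum.inl a => ρ a
  | Sum.inr b => τ b

/-- The composition of substitutions. -/
def comp (ρ : Sub L Δ Θ) (τ : Sub L Γ Δ) : Sub L Γ Θ :=
  fun c => (ρ c).subst τ nilPi

@[simp] theorem eval_fst (M : Struc L) (x : Tuple M Γ) (y : Tuple M Δ) :
    (fst : Sub L (Sum.elim Γ Δ) Γ).eval M (ManySorted.pair x y) = x := rfl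

@[simp] theorem eval_snd (M : Struc L) (x : Tuple M Γ) (y : Tuple M Δ) :
    (snd : Sub L (Sum.elim Γ Δ) Δ).eval M (ManySorted.pair x y) = y := rfl

@[simp] theorem eval_id (M : Struc L) (x : Tuple M Γ) : (id : Sub L Γ Γ).eval M x = x := rfl

@[simp] theorem eval_pair (M : Struc L) (ρ : Sub L Θ Γ) (τ : Sub L Θ Δ) (x : Tuple M Θ) :
    (pair ρ τ).eval M x = ManySorted.pair (ρ.eval M x) (τ.eval M x) := by
  funext c; cases c <;> rfl

@[simp] theorem eval_comp (M : Struc L) (ρ : Sub L Δ Θ) (τ : Sub L Γ Δ) (x : Tuple M Γ) :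
    (comp ρ τ).eval M x = ρ.eval M (τ.eval M x) := by
  funext c
  refine (Term.val_subst M τ nilPi x _ (ρ c)).trans ?_
  exact congrArg (fun e => (ρ c).val M _ e) (eq_nilPi _)

end Sub

/-! ### Operations on formulas -/

namespace Formula

variable {α : Type*} {β : Type*} {Γ : α → L.Sorts} {Δ : β → L.Sorts}

/-- Substitution in a formula. -/
def sub (φ : Formula L Δ) (ρ : Sub L Γ Δ) : Formula L Γ :=
  BForm.subst ρ nilPi φ

@[simp] theorem realize_sub (M : Struc L) (φ : Formula L Δ) (ρ : Sub L Γ Δ) (x : Tuple M Γ) :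
    (φ.sub ρ).Realize M x ↔ φ.Realize M (ρ.eval M x) := by
  refine (BForm.holds_subst M φ ρ _ x _).trans ?_
  exact iff_of_eq (congrArg (fun e => BForm.Holds M _ φ e) (eq_nilPi _))

/-- Implication. -/
def imp (φ ψ : Formula L Γ) : Formula L Γ := BForm.imp φ ψ

/-- Falsity. -/
def bot : Formula L Γ := BForm.falsum

/-- Truth. -/
def top : Formula L Γ := imp bot bot

/-- Negation. -/
def not (φ : Formula L Γ) : Formula L Γ := imp φ bot

/-- Conjunction. -/
def and (φ ψ : Formula L Γ) : Formula L Γ := not (imp φ (not ψ))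

/-- Equivalence. -/
def iff (φ ψ : Formula L Γ) : Formula L Γ := and (imp φ ψ) (imp ψ φ)

/-- Equality of terms. -/
def eq {s : L.Sorts} (t₁ t₂ : Term L Γ [] s) : Formula L Γ := BForm.eq t₁ t₂

@[simp] theorem realize_imp (M : Struc L) (φ ψ : Formula L Γ) (x : Tuple M Γ) :
    (imp φ ψ).Realize M x ↔ (φ.Realize M x → ψ.Realize M x) := Iff.rfl

@[simp] theorem realize_bot (M : Struc L) (x : Tuple M Γ) :
    (bot : Formula L Γ).Realize M x ↔ False := Iff.rfl

@[simp] theorem realize_top (M : Struc L) (x : Tuple M Γ) :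
    (top : Formula L Γ).Realize M x ↔ True := by simp [top]

@[simp] theorem realize_not (M : Struc L) (φ : Formula L Γ) (x : Tuple M Γ) :
    (not φ).Realize M x ↔ ¬ φ.Realize M x := Iff.rfl

@[simp] theorem realize_and (M : Struc L) (φ ψ : Formula L Γ) (x : Tuple M Γ) :
    (and φ ψ).Realize M x ↔ φ.Realize M x ∧ ψ.Realize M x := by simp [and]

@[simp] theorem realize_iff (M : Struc L) (φ ψ : Formula L Γ) (x : Tuple M Γ) :
    (iff φ ψ).Realize M x ↔ (φ.Realize M x ↔ ψ.Realize M x) := by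
  simp [iff, iff_iff_implies_and_implies]

@[simp] theorem realize_eq (M : Struc L) {s : L.Sorts} (t₁ t₂ : Term L Γ [] s)
    (x : Tuple M Γ) : (eq t₁ t₂).Realize M x ↔
      t₁.val M x nilPi = t₂.val M x nilPi := Iff.rfl

/-- Quantification over one variable. -/
theorem exists_all_one (s : L.Sorts) (φ : Formula L (Sum.elim Γ (fun _ : Unit => s))) :
    ∃ ψ : Formula L Γ, ∀ (M : Struc L) (x : Tuple M Γ),
      ψ.Realize M x ↔ ∀ b : M s, φ.Realize M (pair x (fun _ => b)) := by
  -- The last free variable becomes the bound variable introduced by `BForm.all`.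
  let ρ : ∀ a, Term L Γ [s] (Sum.elim Γ (fun _ : Unit => s) a) := fun a => match a with
    | Sum.inl a => .free a
    | Sum.inr _ => .bound (Δ := [s]) ⟨0, Nat.succ_pos _⟩
  refine ⟨BForm.all s (BForm.subst ρ nilPi φ), fun M x => forall_congr' fun b => ?_⟩
  refine (BForm.holds_subst M φ ρ _ x (consTuple b nilPi)).trans ?_
  have h1 : (fun a => (ρ a).val M x (consTuple b nilPi)) =
      pair x (fun _ : Unit => b) := by
    funext a; rcases a with a | a <;> rfl
  rw [h1]
  exact iff_of_eq (congrArg (fun e => BForm.Holds M _ φ e) (eq_nilPi _))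

/-- Quantification over a finite tuple of variables. -/
theorem exists_all {κ : Type} [Finite κ] : ∀ {Δ : κ → L.Sorts} (φ : Formula L (Sum.elim Γ Δ)),
    ∃ ψ : Formula L Γ, ∀ (M : Struc L) (x : Tuple M Γ),
      ψ.Realize M x ↔ ∀ y : Tuple M Δ, φ.Realize M (pair x y) := by
  refine Finite.induction_empty_option (P := fun κ => ∀ {Δ : κ → L.Sorts}
    (φ : Formula L (Sum.elim Γ Δ)), ∃ ψ : Formula L Γ, ∀ (M : Struc L) (x : Tuple M Γ),
      ψ.Realize M x ↔ ∀ y : Tuple M Δ, φ.Realize M (pair x y)) ?_ ?_ ?_ κ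
  · intro κ κ' e ih Δ φ
    -- The sort of a variable depends on its index. Writing `b` as `e k` and eliminating the
    -- equation yields the right variable without casts.
    have hb : ∀ b, ∃ t : Term L (Sum.elim Γ (Δ ∘ e)) [] (Δ b), ∀ (M : Struc L) (x : Tuple M Γ)
        (y : Tuple M Δ), t.val M (pair x (fun k => y (e k))) nilPi = y b := by
      intro b
      obtain ⟨k, rfl⟩ := e.surjective b
      exact ⟨Sub.snd (Γ := Γ) (Δ := Δ ∘ e) k, fun _ _ _ => rfl⟩
    choose t ht using hb
    have hρ : ∀ (M : Struc L) (x : Tuple M Γ) (y : Tuple M Δ),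
        (Sub.pair Sub.fst t).eval M (pair x (fun k => y (e k))) = pair x y := by
      intro M x y
      funext a
      rcases a with a | b
      · rfl
      · exact ht b M x y
    obtain ⟨ψ, hψ⟩ := ih (φ.sub (Sub.pair Sub.fst t))
    refine ⟨ψ, fun M x => (hψ M x).trans ⟨fun h y => ?_, fun h y => ?_⟩⟩
    · have := h (fun k => y (e k))
      rwa [realize_sub, hρ] at this
    · obtain ⟨y', rfl⟩ : ∃ y' : Tuple M Δ, y = fun k => y' (e k) :=
        ⟨e.piCongrLeft (fun b => M (Δ b)) y,
          funext fun k => (Equiv.piCongrLeft_apply_apply (fun b => M (Δ b)) e y k).symm⟩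
      rw [realize_sub, hρ]
      exact h y'
  · intro Δ φ
    refine ⟨φ.sub (Sub.pair Sub.id (fun a => a.elim)), fun M x => ?_⟩
    rw [realize_sub, Sub.eval_pair, Sub.eval_id]
    refine ⟨fun h y => ?_, fun h => h _⟩
    convert h using 2
    funext a; exact a.elim
  · intro κ _ ih Δ φ
    let ρ : Sub L (Sum.elim (Sum.elim Γ (fun k => Δ (some k))) (fun _ : Unit => Δ none))
        (Sum.elim Γ Δ) := fun a => match a with
      | Sum.inl a => Sub.fst.comp Sub.fst a
      | Sum.inr none => Sub.snd ()
      | Sum.inr (some k) => Sub.snd.comp Sub.fst k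
    obtain ⟨ψ, hψ⟩ := exists_all_one _ (φ.sub ρ)
    obtain ⟨χ, hχ⟩ := ih ψ
    refine ⟨χ, fun M x => (hχ M x).trans ⟨fun h y => ?_, fun h y => ?_⟩⟩
    · have := (hψ M _).1 (h (fun k => y (some k))) (y none)
      rw [realize_sub] at this
      convert this using 1
      funext a; rcases a with a | _ | k <;> rfl
    · rw [hψ]
      intro b
      rw [realize_sub]
      convert h (fun k => match k with | none => b | some k => y k) using 1
      funext a; rcases a with a | _ | k <;> rfl

/-- Universal quantification over a finite tuple of variables. -/
noncomputable def all {κ : Type} [Finite κ] {Δ : κ → L.Sorts} (φ : Formula L (Sum.elim Γ Δ)) :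
    Formula L Γ := (exists_all φ).choose

/-- Existential quantification over a finite tuple of variables. -/
noncomputable def ex {κ : Type} [Finite κ] {Δ : κ → L.Sorts} (φ : Formula L (Sum.elim Γ Δ)) :
    Formula L Γ := not (all (not φ))

@[simp] theorem realize_all (M : Struc L) {κ : Type} [Finite κ] {Δ : κ → L.Sorts}
    (φ : Formula L (Sum.elim Γ Δ)) (x : Tuple M Γ) :
    (all φ).Realize M x ↔ ∀ y : Tuple M Δ, φ.Realize M (pair x y) :=
  (exists_all φ).choose_spec M x

@[simp] theorem realize_ex (M : Struc L) {κ : Type} [Finite κ] {Δ : κ → L.Sorts}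
    (φ : Formula L (Sum.elim Γ Δ)) (x : Tuple M Γ) :
    (ex φ).Realize M x ↔ ∃ y : Tuple M Δ, φ.Realize M (pair x y) := by
  simp [ex]

theorem exists_conj (l : List (Formula L Γ)) : ∃ ψ : Formula L Γ, ∀ (M : Struc L)
    (x : Tuple M Γ), ψ.Realize M x ↔ ∀ φ ∈ l, φ.Realize M x := by
  induction l with
  | nil => exact ⟨top, fun M x => by simp⟩
  | cons φ l ih =>
    obtain ⟨ψ, h⟩ := ih
    exact ⟨and φ ψ, fun M x => by simp [h]⟩

theorem exists_iAnd {τ : Type*} [Finite τ] (φ : τ → Formula L Γ) : ∃ ψ : Formula L Γ,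
    ∀ (M : Struc L) (x : Tuple M Γ), ψ.Realize M x ↔ ∀ t, (φ t).Realize M x := by
  cases nonempty_fintype τ
  obtain ⟨ψ, h⟩ := exists_conj (Finset.univ.toList.map φ)
  exact ⟨ψ, fun M x => (h M x).trans (by simp)⟩

/-- Conjunction of a finite family. -/
noncomputable def iAnd {τ : Type*} [Finite τ] (φ : τ → Formula L Γ) : Formula L Γ :=
  (exists_iAnd φ).choose

@[simp] theorem realize_iAnd (M : Struc L) {τ : Type*} [Finite τ] (φ : τ → Formula L Γ)
    (x : Tuple M Γ) : (iAnd φ).Realize M x ↔ ∀ t, (φ t).Realize M x :=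
  (exists_iAnd φ).choose_spec M x

end Formula

/-! ### Finite support -/

section Support

variable {α : Type w} {Γ : α → L.Sorts}

/-- The free variables lie in `S`. -/
def BForm.SupportedBy (S : Set α) {Δ : List L.Sorts} (φ : BForm L Γ Δ) : Prop :=
  ∃ φ' : BForm L (fun a : S => Γ a) Δ, ∀ (M : Struc L) (x : Tuple M Γ) (e : Tuple M Δ.get),
    φ.Holds M x e ↔ φ'.Holds M (fun k : S => x k) e

/-- Allowing every larger `S'` makes the induction work: all subterms can be rewritten over the
union of their supports. -/
theorem Term.exists_support {Δ : List L.Sorts} {s : L.Sorts} (t : Term L Γ Δ s) :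
    ∃ S : Set α, S.Finite ∧ ∀ S', S ⊆ S' → ∃ t' : Term L (fun a : S' => Γ a) Δ s,
      ∀ (M : Struc L) (x : Tuple M Γ) (e : Tuple M Δ.get),
        t.val M x e = t'.val M (fun k : S' => x k) e := by
  induction t with
  | free a =>
    exact ⟨{a}, Set.finite_singleton a, fun S' h =>
      ⟨.free (Γ := fun a : S' => Γ a) ⟨a, h rfl⟩, fun _ _ _ => rfl⟩⟩
  | bound k => exact ⟨∅, Set.finite_empty, fun S' _ => ⟨.bound k, fun _ _ _ => rfl⟩⟩
  | app f ts ih =>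
    choose S hS h using ih
    refine ⟨⋃ k, S k, Set.finite_iUnion hS, fun S' hS' => ?_⟩
    choose t' ht' using fun k => h k S' ((Set.subset_iUnion S k).trans hS')
    exact ⟨.app f t', fun M x e => congrArg (M.funMap f) (funext fun k => ht' k M x e)⟩

theorem BForm.exists_support {Δ : List L.Sorts} (φ : BForm L Γ Δ) :
    ∃ S : Set α, S.Finite ∧ ∀ S', S ⊆ S' → φ.SupportedBy S' := by
  induction φ with
  | falsum => exact ⟨∅, Set.finite_empty, fun S' _ => ⟨.falsum, fun _ _ _ => Iff.rfl⟩⟩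
  | eq t₁ t₂ =>
    obtain ⟨S₁, h₁, k₁⟩ := t₁.exists_support
    obtain ⟨S₂, h₂, k₂⟩ := t₂.exists_support
    refine ⟨S₁ ∪ S₂, h₁.union h₂, fun S' hS' => ?_⟩
    obtain ⟨t₁', e₁⟩ := k₁ S' (Set.subset_union_left.trans hS')
    obtain ⟨t₂', e₂⟩ := k₂ S' (Set.subset_union_right.trans hS')
    exact ⟨.eq t₁' t₂', fun M x e => by simp only [BForm.Holds, e₁, e₂]⟩
  | rel R ts =>
    choose S hS h using fun k => (ts k).exists_support
    refine ⟨⋃ k, S k, Set.finite_iUnion hS, fun S' hS' => ?_⟩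
    choose t' ht' using fun k => h k S' ((Set.subset_iUnion S k).trans hS')
    exact ⟨.rel R t', fun M x e => by simp only [BForm.Holds, ht']⟩
  | imp φ ψ ih₁ ih₂ =>
    obtain ⟨S₁, h₁, k₁⟩ := ih₁
    obtain ⟨S₂, h₂, k₂⟩ := ih₂
    refine ⟨S₁ ∪ S₂, h₁.union h₂, fun S' hS' => ?_⟩
    obtain ⟨t₁', e₁⟩ := k₁ S' (Set.subset_union_left.trans hS')
    obtain ⟨t₂', e₂⟩ := k₂ S' (Set.subset_union_right.trans hS')
    exact ⟨.imp t₁' t₂', fun M x e => by simp only [BForm.Holds, e₁, e₂]⟩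
  | all s φ ih =>
    obtain ⟨S, h, k⟩ := ih
    refine ⟨S, h, fun S' hS' => ?_⟩
    obtain ⟨t, e⟩ := k S' hS'
    exact ⟨.all s t, fun M x e' => forall_congr' fun b => e M x _⟩

/-- A formula has finitely many free variables. -/
theorem Formula.exists_support (φ : Formula L Γ) :
    ∃ (n : ℕ) (f : Fin n → α) (φ' : Formula L (fun k => Γ (f k))), ∀ (M : Struc L)
      (x : Tuple M Γ), φ.Realize M x ↔ φ'.Realize M (fun k => x (f k)) := by
  obtain ⟨S, hS, h⟩ := BForm.exists_support φ
  obtain ⟨φ', hφ⟩ := h S subset_rfl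
  have := hS.to_subtype
  obtain ⟨n, ⟨e⟩⟩ := Finite.exists_equiv_fin S
  have ht : ∀ a : S, ∃ t : Term L (fun k => Γ (e.symm k)) [] (Γ a), ∀ (M : Struc L)
      (x : Tuple M Γ), t.val M (fun k => x (e.symm k)) nilPi = x a := by
    intro a
    obtain ⟨k, rfl⟩ := e.symm.surjective a
    exact ⟨.free (Γ := fun k => Γ (e.symm k)) k, fun _ _ => rfl⟩
  choose ρ hρ using ht
  refine ⟨n, fun k => e.symm k, Formula.sub φ' ρ, fun M x => (hφ M x _).trans ?_⟩
  rw [Formula.realize_sub]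
  have : Sub.eval M ρ (fun k => x (e.symm k)) = fun k : S => x k := funext fun a => hρ a M x
  rw [this]
  exact Iff.rfl

end Support

end ManySorted

namespace ManySorted

variable {L : Lang.{u}}

/-- A formula in two groups of variables only involves finitely many of each. -/
theorem Formula.exists_support_pair {α : Type*} {β : Type*} {Γ : α → L.Sorts} {Δ : β → L.Sorts}
    (φ : Formula L (Sum.elim Γ Δ)) :
    ∃ (ι κ : Type) (_ : Finite ι) (_ : Finite κ) (f : ι → α) (g : κ → β)
      (φ' : Formula L (Sum.elim (fun k => Γ (f k)) (fun k => Δ (g k)))),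
      ∀ (M : Struc L) (x : Tuple M Γ) (y : Tuple M Δ), φ.Realize M (pair x y) ↔
        φ'.Realize M (pair (fun k => x (f k)) (fun k => y (g k))) := by
  obtain ⟨n, h, φ', hφ⟩ := φ.exists_support
  let ι := {k // ∃ a, h k = Sum.inl a}
  let κ := {k // ∃ a, h k = Sum.inr a}
  let f : ι → α := fun k => k.2.choose
  let g : κ → β := fun k => k.2.choose
  have ht : ∀ (k : Fin n), ∃ t : Term L (Sum.elim (fun k => Γ (f k)) (fun k => Δ (g k))) []
      (Sum.elim Γ Δ (h k)), ∀ (M : Struc L) (x : Tuple M Γ) (y : Tuple M Δ),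
        t.val M (pair (fun k => x (f k)) (fun k => y (g k))) nilPi = pair x y (h k) := by
    intro k
    -- Replacing `h k` by a free `c` lets the equation be eliminated, although the sort of the term
    -- depends on it.
    have key : ∀ c, (∃ k', c = Sum.inl (f k')) ∨ (∃ k', c = Sum.inr (g k')) →
        ∃ t : Term L (Sum.elim (fun k => Γ (f k)) (fun k => Δ (g k))) []
          (Sum.elim Γ Δ c), ∀ (M : Struc L) (x : Tuple M Γ) (y : Tuple M Δ),
          t.val M (pair (fun k => x (f k)) (fun k => y (g k))) nilPi = pair x y c := by
      rintro _ (⟨k', rfl⟩ | ⟨k', rfl⟩)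
      · exact ⟨Sub.fst (Δ := fun k => Δ (g k)) k', fun _ _ _ => rfl⟩
      · exact ⟨Sub.snd (Γ := fun k => Γ (f k)) k', fun _ _ _ => rfl⟩
    apply key
    rcases hk : h k with a | b
    · exact Or.inl ⟨⟨k, a, hk⟩, hk.symm.trans (⟨k, a, hk⟩ : ι).2.choose_spec⟩
    · exact Or.inr ⟨⟨k, b, hk⟩, hk.symm.trans (⟨k, b, hk⟩ : κ).2.choose_spec⟩
  choose ρ hρ using ht
  refine ⟨ι, κ, inferInstance, inferInstance, f, g, φ'.sub ρ, fun M x y => (hφ M _).trans ?_⟩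
  rw [Formula.realize_sub]
  have : Sub.eval M ρ (pair (fun k => x (f k)) (fun k => y (g k))) = fun k => pair x y (h k) :=
    funext fun k => hρ k M x y
  rw [this]

/-- Only finitely many of the parameters are involved in a formula. -/
theorem Formula.exists_support_left {α : Type*} {β : Type*} {Γ : α → L.Sorts} {Δ : β → L.Sorts}
    (φ : Formula L (Sum.elim Γ Δ)) :
    ∃ (ι : Type) (_ : Finite ι) (f : ι → α) (φ' : Formula L (Sum.elim (fun k => Γ (f k)) Δ)),
      ∀ (M : Struc L) (x : Tuple M Γ) (y : Tuple M Δ), φ.Realize M (pair x y) ↔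
        φ'.Realize M (pair (fun k => x (f k)) y) := by
  obtain ⟨ι, κ, _, _, f, g, φ', h⟩ := φ.exists_support_pair
  refine ⟨ι, inferInstance, f, φ'.sub (Sub.pair Sub.fst
    (fun k => Sub.snd (Γ := fun k => Γ (f k)) (Δ := Δ) (g k))), fun M x y => ?_⟩
  rw [h, Formula.realize_sub, Sub.eval_pair]
  rfl

/-! ### Definability with parameters -/

section Definable

variable {M : Struc L}

/-- `P` is definable with parameters from `B`. -/
def DefinableOver (M : Struc L) (B : Subsets M) {κ : Type*} (Δ : κ → L.Sorts)
    (P : Tuple M Δ → Prop) : Prop :=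
  ∃ φ : Formula L (Sum.elim (fun a : (Σ t, B t) => a.1) Δ),
    ∀ y, φ.Realize M (pair (fun a : (Σ t, B t) => a.2.1) y) ↔ P y

theorem mem_dcl_iff {B : Subsets M} {s : L.Sorts} {b : M s} :
    b ∈ dcl M B s ↔ DefinableOver M B (fun _ : Unit => s) (fun y => y () = b) :=
  ⟨fun ⟨φ, h⟩ => ⟨φ, fun y => h (y ())⟩, fun ⟨φ, h⟩ => ⟨φ, fun y => h (fun _ => y)⟩⟩

theorem definableOver_of_params {B : Subsets M} {α κ : Type*} {Γ : α → L.Sorts}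
    {Δ : κ → L.Sorts} (φ : Formula L (Sum.elim Γ Δ)) (c : Tuple M Γ)
    (hc : ∀ j, c j ∈ B (Γ j)) :
    DefinableOver M B Δ (fun y => φ.Realize M (pair c y)) := by
  refine ⟨φ.sub (Sub.pair (fun j => Sub.fst (Γ := fun a : (Σ t, B t) => a.1) (Δ := Δ)
    ⟨Γ j, c j, hc j⟩) Sub.snd), fun y => ?_⟩
  rw [Formula.realize_sub, Sub.eval_pair]
  rfl

theorem mem_dcl_of_definableOver {B : Subsets M} {κ : Type} [Finite κ] {Δ : κ → L.Sorts}
    {x : Tuple M Δ} (h : DefinableOver M B Δ (fun y => y = x)) (j : κ) :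
    x j ∈ dcl M B (Δ j) := by
  obtain ⟨φ, hφ⟩ := h
  refine ⟨Formula.ex (Formula.and (φ.sub (Sub.pair (Sub.fst.comp Sub.fst) Sub.snd))
    (Formula.eq (Sub.snd (L := L) j)
      (Sub.snd.comp (Sub.fst (Δ := Δ)) ()))), fun y => ?_⟩
  simp only [Formula.realize_ex, Formula.realize_and, Formula.realize_sub, Sub.eval_pair,
    Sub.eval_comp, Sub.eval_fst, Sub.eval_snd, hφ]
  constructor
  · rintro ⟨z, rfl, h⟩
    exact h.symm
  · rintro rfl
    exact ⟨x, rfl, rfl⟩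

theorem definableOver_of_mem_dcl {B : Subsets M} {κ : Type*} [Finite κ] {Δ : κ → L.Sorts}
    {x : Tuple M Δ} (h : ∀ j, x j ∈ dcl M B (Δ j)) : DefinableOver M B Δ (fun y => y = x) := by
  choose φ hφ using h
  refine ⟨Formula.iAnd fun j => (φ j).sub
    (Sub.pair Sub.fst (fun _ => Sub.snd j)), fun y => ?_⟩
  simp only [Formula.realize_iAnd, Formula.realize_sub, Sub.eval_pair, Sub.eval_fst]
  rw [funext_iff]
  exact forall_congr' fun j => hφ j (y j)

theorem subset_dcl (B : Subsets M) : B ≤ dcl M B := by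
  intro s b hb
  exact ⟨Formula.eq (Sub.snd (Γ := fun a : (Σ t, B t) => a.1) (Δ := fun _ : Unit => s) ())
    (Sub.fst (Γ := fun a : (Σ t, B t) => a.1) (Δ := fun _ : Unit => s) ⟨s, b, hb⟩),
    fun y => Iff.rfl⟩

/-- Only finitely many parameters from `dcl M B` occur. They are quantified existentially, subject
to a formula over `B` that defines them. -/
theorem definableOver_of_dcl {B : Subsets M} {κ : Type*} {Δ : κ → L.Sorts}
    {P : Tuple M Δ → Prop} (h : DefinableOver M (dcl M B) Δ P) : DefinableOver M B Δ P := by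
  obtain ⟨φ, hφ⟩ := h
  obtain ⟨ι, _, f, φ', hφ'⟩ := φ.exists_support_left
  obtain ⟨ψ, hψ⟩ := definableOver_of_mem_dcl (B := B) (Δ := fun k => (f k).1)
    (x := fun k => (f k).2.1) (fun k => (f k).2.2)
  refine ⟨Formula.ex (Formula.and (ψ.sub (Sub.pair (Sub.fst.comp Sub.fst) Sub.snd))
    (φ'.sub (Sub.pair Sub.snd (Sub.snd.comp Sub.fst)))), fun y => ?_⟩
  simp only [Formula.realize_ex, Formula.realize_and, Formula.realize_sub, Sub.eval_pair,
    Sub.eval_comp, Sub.eval_fst, Sub.eval_snd, hψ]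
  rw [← hφ, hφ']
  simp

theorem isDefClosed_dcl (B : Subsets M) : IsDefClosed M (dcl M B) := by
  intro s b hb
  rw [mem_dcl_iff] at hb ⊢
  exact definableOver_of_dcl hb

/-- A point of a definable set that is defined by parameters from a definably closed set `B`
has its components in `B`. -/
theorem IsDefClosed.mem_of_unique {B : Subsets M} (hB : IsDefClosed M B) {X : DefSet L}
    (x : X.pts M) (h : DefinableOver M B X.sort
      (fun y => ∃ hy : X.form.Realize M y, (⟨y, hy⟩ : X.pts M) = x)) (j : X.ι) :
    x.1 j ∈ B (X.sort j) := by
  have := X.fin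
  refine hB _ (mem_dcl_of_definableOver ?_ j)
  obtain ⟨φ, hφ⟩ := h
  refine ⟨φ, fun y => (hφ y).trans ⟨?_, ?_⟩⟩
  · rintro ⟨hy, rfl⟩
    rfl
  · rintro rfl
    exact ⟨x.2, rfl⟩

/-- Variant of `IsDefClosed.mem_of_unique` with a formula whose parameters are displayed. -/
theorem IsDefClosed.mem_of_formula {B : Subsets M} (hB : IsDefClosed M B) {X : DefSet L}
    (x : X.pts M) {α : Type*} {Γ : α → L.Sorts} (φ : Formula L (Sum.elim Γ X.sort))
    (c : Tuple M Γ) (hc : ∀ j, c j ∈ B (Γ j))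
    (h : ∀ y : X.pts M, φ.Realize M (pair c y.1) ↔ y = x) (j : X.ι) :
    x.1 j ∈ B (X.sort j) := by
  refine hB.mem_of_unique x ?_ j
  obtain ⟨ψ, hψ⟩ := definableOver_of_params (B := B)
    (Formula.and φ (X.form.sub Sub.snd)) c hc
  refine ⟨ψ, fun y => (hψ y).trans ?_⟩
  simp only [Formula.realize_and, Formula.realize_sub, Sub.eval_snd]
  constructor
  · rintro ⟨h1, h2⟩
    exact ⟨h2, (h ⟨y, h2⟩).1 h1⟩
  · rintro ⟨h1, h2⟩
    exact ⟨(h ⟨y, h1⟩).2 h2, h1⟩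

/-! ### Elementary maps -/

/-- The definition of `IsElementary` only tests finite tuples. Finite support extends it to
arbitrary ones, such as the tuple of all elements of a set of parameters. -/
theorem IsElementary.realize {N : Struc L} {B : Subsets M} {f : ∀ s, B s → N s}
    (hf : IsElementary M N B f) {α : Type*} {Γ : α → L.Sorts} (φ : Formula L Γ)
    (x : ∀ k, B (Γ k)) :
    φ.Realize M (fun k => (x k).1) ↔ φ.Realize N (fun k => f _ (x k)) := by
  obtain ⟨n, g, φ', h⟩ := φ.exists_support
  rw [h, h]
  exact hf ⟨Fin n, fun k => Γ (g k), φ'⟩ (fun k => x (g k))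

theorem IsElementary.realize_pair {N : Struc L} {B : Subsets M} {f : ∀ s, B s → N s}
    (hf : IsElementary M N B f) {α β : Type*} {Γ : α → L.Sorts} {Δ : β → L.Sorts}
    (φ : Formula L (Sum.elim Γ Δ)) (x : ∀ k, B (Γ k)) (y : ∀ k, B (Δ k)) :
    φ.Realize M (pair (fun k => (x k).1) (fun k => (y k).1)) ↔
      φ.Realize N (pair (fun k => f _ (x k)) (fun k => f _ (y k))) := by
  have h := hf.realize φ (fun k => match k with | Sum.inl a => x a | Sum.inr b => y b)
  have h1 : pair (fun k => (x k).1) (fun k => (y k).1) = fun k : α ⊕ β =>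
      (match k with | Sum.inl a => x a | Sum.inr b => y b : B (Sum.elim Γ Δ k)).1 := by
    funext k; cases k <;> rfl
  have h2 : pair (fun k => f _ (x k)) (fun k => f _ (y k)) = fun k : α ⊕ β =>
      f _ (match k with | Sum.inl a => x a | Sum.inr b => y b : B (Sum.elim Γ Δ k)) := by
    funext k; cases k <;> rfl
  rw [h1, h2]
  exact h

/-- Elementary maps that agree on `C` agree on the definable closure of `C`. -/
theorem IsElementary.eq_of_eqOn {N : Struc L} {B : Subsets M} {f f' : ∀ s, B s → N s}
    (hf : IsElementary M N B f) (hf' : IsElementary M N B f') {C : Subsets M} (hC : C ≤ B)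
    (h : ∀ s (c : C s), f s ⟨c.1, hC s c.2⟩ = f' s ⟨c.1, hC s c.2⟩) {s : L.Sorts} (b : B s)
    (hb : b.1 ∈ dcl M C s) : f s b = f' s b := by
  obtain ⟨φ, hφ⟩ := hb
  let c : ∀ a : (Σ t, C t), B a.1 := fun a => ⟨a.2.1, hC a.1 a.2.2⟩
  have hc : (fun a => f a.1 (c a)) = fun a => f' a.1 (c a) := funext fun a => h a.1 a.2
  have h1 := (hf.realize_pair φ c (fun _ => b)).1 ((hφ b.1).2 rfl)
  have h2 := (hf'.realize_pair φ c (fun _ => b)).1 ((hφ b.1).2 rfl)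
  -- That `φ(c, ·)` has at most one solution is a formula about `c`, so it transfers along `f`.
  have h3 := (hf.realize (Formula.all (Formula.all (Formula.imp
    (φ.sub (Sub.pair (Sub.fst.comp Sub.fst) (Sub.snd.comp Sub.fst)))
    (Formula.imp (φ.sub (Sub.pair (Sub.fst.comp Sub.fst) Sub.snd))
      (Formula.eq (Sub.snd.comp Sub.fst ()) (Sub.snd ())))))) c).1 (by
    simp only [Formula.realize_all, Formula.realize_imp, Formula.realize_sub, Sub.eval_pair,
      Sub.eval_comp, Sub.eval_fst, Sub.eval_snd]
    intro y z hy hz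
    exact ((hφ (y ())).1 hy).trans ((hφ (z ())).1 hz).symm)
  simp only [Formula.realize_all, Formula.realize_imp, Formula.realize_sub, Sub.eval_pair,
    Sub.eval_comp, Sub.eval_fst, Sub.eval_snd] at h3
  rw [← hc] at h2
  exact h3 _ _ h1 h2

/-- The permutations of the sorts of `M` that preserve all definable sets. -/
def IsAut (M : Struc L) (τ : ∀ s, Equiv.Perm (M s)) : Prop :=
  ∀ (Q : DefSet L) (x : Tuple M Q.sort),
    Q.form.Realize M x ↔ Q.form.Realize M (fun j => τ _ (x j))

theorem IsAut.isElementary {τ : ∀ s, Equiv.Perm (M s)} (h : IsAut M τ) (B : Subsets M) :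
    IsElementary M M B (fun s b => τ s b.1) :=
  fun Q x => h Q (fun k => (x k).1)

theorem isElementary_of_mem_autGroup {B F : Subsets M} {σ : ∀ s, Equiv.Perm (B s)}
    (h : σ ∈ autGroup M B F) : IsElementary M M B (fun s b => (σ s b).1) :=
  h.1

/-! ### Extension of elementary maps -/

section Extension

variable {α : Type*} {Γ : α → L.Sorts}

/-- Every element of `M` is definable over the tuple `c`. -/
def Generates (M : Struc L) (c : Tuple M Γ) : Prop :=
  ∀ s (b : M s), ∃ φ : Formula L (Sum.elim Γ (fun _ : Unit => s)),
    ∀ y : M s, φ.Realize M (pair c (fun _ => y)) ↔ y = b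

/-- `b` has the same type over `c` as `b'` over `c'`. -/
def SameType (M : Struc L) (c c' : Tuple M Γ) (s : L.Sorts) (b b' : M s) : Prop :=
  ∀ φ : Formula L (Sum.elim Γ (fun _ : Unit => s)),
    φ.Realize M (pair c (fun _ => b)) ↔ φ.Realize M (pair c' (fun _ => b'))

theorem SameType.symm {c c' : Tuple M Γ} {s : L.Sorts} {b b' : M s}
    (h : SameType M c c' s b b') : SameType M c' c s b' b := fun φ => (h φ).symm

variable {c c' : Tuple M Γ}

theorem sameType_self (hc : ∀ φ : Formula L Γ, φ.Realize M c ↔ φ.Realize M c') (i : α) : SameType M c c' (Γ i) (c i) (c' i) := by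
  intro φ
  have := hc (φ.sub (Sub.pair Sub.id (fun _ => Sub.id i)))
  rwa [Formula.realize_sub, Formula.realize_sub, Sub.eval_pair, Sub.eval_pair] at this

/-- The formula `φ` defining `b` over `c` isolates its type: if `ψ(c, b)` holds, then `φ(c, ·)`
implies `ψ(c, ·)`, and this implication transfers to `c'`. So any solution of `φ(c', ·)` serves. -/
theorem SameType.exists_right (hc : ∀ φ : Formula L Γ, φ.Realize M c ↔ φ.Realize M c')
    (hg : Generates M c) {s : L.Sorts} (b : M s) : ∃ b', SameType M c c' s b b' := by
  obtain ⟨φ, hφ⟩ := hg s b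
  obtain ⟨z, hz⟩ : ∃ z : Tuple M (fun _ : Unit => s), φ.Realize M (pair c' z) := by
    rw [← Formula.realize_ex, ← hc, Formula.realize_ex]
    exact ⟨fun _ => b, (hφ b).2 rfl⟩
  have key : ∀ ψ : Formula L (Sum.elim Γ (fun _ : Unit => s)),
      ψ.Realize M (pair c (fun _ => b)) → ψ.Realize M (pair c' z) := by
    intro ψ h
    have h1 : (Formula.all (Formula.imp φ ψ)).Realize M c := by
      simp only [Formula.realize_all, Formula.realize_imp]
      intro y hy
      obtain rfl : y () = b := (hφ (y ())).1 hy
      exact h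
    rw [hc, Formula.realize_all] at h1
    exact h1 z hz
  refine ⟨z (), fun ψ => ⟨key ψ, fun h => ?_⟩⟩
  by_contra h'
  exact key (Formula.not ψ) h' h

theorem SameType.eq_right (hg : Generates M c') {s : L.Sorts} {b b₁ b₂ : M s}
    (h₁ : SameType M c c' s b b₁) (h₂ : SameType M c c' s b b₂) : b₁ = b₂ := by
  obtain ⟨φ, hφ⟩ := hg s b₂
  exact (hφ b₁).1 ((h₁ φ).1 ((h₂ φ).2 ((hφ b₂).2 rfl)))

/-- Types of single coordinates suffice, because each coordinate is isolated over `c`: the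
conjunction of the isolating formulas implies `ψ`, and this implication transfers to `c'`. -/
theorem SameType.realize (hc : ∀ φ : Formula L Γ, φ.Realize M c ↔ φ.Realize M c')
    (hg : Generates M c) {κ : Type} [Finite κ] {Δ : κ → L.Sorts} {x x' : Tuple M Δ}
    (h : ∀ k, SameType M c c' (Δ k) (x k) (x' k)) (ψ : Formula L Δ) (hx : ψ.Realize M x) :
    ψ.Realize M x' := by
  choose φ hφ using fun k => hg (Δ k) (x k)
  have h1 : (Formula.all (Formula.imp (Formula.iAnd fun k => (φ k).sub
      (Sub.pair Sub.fst (fun _ => Sub.snd k))) (ψ.sub Sub.snd))).Realize M c := by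
    simp only [Formula.realize_all, Formula.realize_imp, Formula.realize_iAnd,
      Formula.realize_sub, Sub.eval_pair, Sub.eval_fst, Sub.eval_snd]
    intro y hy
    obtain rfl : y = x := funext fun k => (hφ k (y k)).1 (hy k)
    exact hx
  rw [hc] at h1
  simp only [Formula.realize_all, Formula.realize_imp, Formula.realize_iAnd,
    Formula.realize_sub, Sub.eval_pair, Sub.eval_fst, Sub.eval_snd] at h1
  exact h1 x' fun k => (h k (φ k)).1 ((hφ k (x k)).2 rfl)

/-- Two generating tuples of the same type are conjugate. -/
theorem exists_isAut (hc : ∀ φ : Formula L Γ, φ.Realize M c ↔ φ.Realize M c')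
    (hg : Generates M c) (hg' : Generates M c') :
    ∃ τ : ∀ s, Equiv.Perm (M s), IsAut M τ ∧ ∀ k, τ _ (c k) = c' k := by
  have hc' := fun φ => (hc φ).symm
  -- The automorphism sends `b` to the element having over `c'` the type of `b` over `c`; exchanging
  -- `c` and `c'` gives its inverse.
  choose f hf using fun s => SameType.exists_right (s := s) hc hg
  choose g hgg using fun s => SameType.exists_right (s := s) hc' hg'
  refine ⟨fun s => ⟨f s, g s, fun b => ?_, fun b => ?_⟩, fun Q x => ?_, fun k => ?_⟩
  · exact SameType.eq_right hg (hgg s (f s b)) (hf s b).symm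
  · exact SameType.eq_right hg' (hf s (g s b)) (hgg s b).symm
  · have := Q.fin
    exact ⟨SameType.realize hc hg (fun k => hf _ (x k)) Q.form,
      SameType.realize hc' hg' (fun k => (hf _ (x k)).symm) Q.form⟩
  · exact SameType.eq_right hg' (hf _ (c k)) (sameType_self hc k)

end Extension

end Definable

end ManySorted

namespace ManySorted

variable {L₀ L : Lang.{u}} {T₀ : Theory L₀} {T : Theory L}

/-! ### Formulas of an interpreted structure -/

section Translation

variable (i : Interp T₀ T)

/-- Equality of two tuples of terms. -/
noncomputable def Formula.eqTuple {α κ : Type*} [Finite κ] {Γ : α → L.Sorts} {Δ : κ → L.Sorts}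
    (ρ τ : Sub L Γ Δ) : Formula L Γ :=
  Formula.iAnd fun k => Formula.eq (ρ k) (τ k)

@[simp] theorem Formula.realize_eqTuple {α κ : Type*} [Finite κ] {Γ : α → L.Sorts}
    {Δ : κ → L.Sorts} (ρ τ : Sub L Γ Δ) (M : Struc L) (x : Tuple M Γ) :
    (Formula.eqTuple ρ τ).Realize M x ↔ ρ.eval M x = τ.eval M x := by
  rw [Formula.eqTuple, Formula.realize_iAnd, funext_iff]
  rfl

theorem Interp.realize_graph (i : Interp T₀ T) (M : Model T) {a : List L₀.Sorts} {s : L₀.Sorts}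
    (f : L₀.Fun a s) (z : Tuple (i.res M).toStruc a.get) (y : (i.res M).carrier s) :
    (i.graph f).Realize M.toStruc (pair (flatten z) (Subtype.val y)) ↔
      (i.res M).funMap f z = y := by
  have h := i.graph_total M f z
  constructor
  · intro hy
    exact (h.unique hy h.choose_spec.1).symm
  · rintro rfl
    exact h.choose_spec.1

/-- The projection from a product of sets `obj (Γ k)` to a factor. -/
def flatProj (obj : L₀.Sorts → DefSet L) {κ : Type*} (Γ : κ → L₀.Sorts) (k : κ) :
    Sub L (flatSort obj Γ) (obj (Γ k)).sort :=
  fun j => Sub.id (L := L) (Γ := flatSort obj Γ) ⟨k, j⟩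

@[simp] theorem eval_flatProj (obj : L₀.Sorts → DefSet L) {κ : Type*} (Γ : κ → L₀.Sorts)
    (k : κ) (M : Struc L) (y : Tuple M (flatSort obj Γ)) :
    (flatProj obj Γ k).eval M y = fun j => y ⟨k, j⟩ := rfl

/-- The formula saying that a tuple lies in the product of the sets `i.obj (Γ k)`. -/
noncomputable def Interp.domain {κ : Type*} [Finite κ] (Γ : κ → L₀.Sorts) :
    Formula L (flatSort i.obj Γ) :=
  Formula.iAnd fun k => (i.obj (Γ k)).form.sub (flatProj i.obj Γ k)

theorem Interp.realize_domain {κ : Type*} [Finite κ] (Γ : κ → L₀.Sorts) (M : Model T)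
    (y : Tuple M.toStruc (flatSort i.obj Γ)) : (i.domain Γ).Realize M.toStruc y ↔
      ∃ z : Tuple (i.res M).toStruc Γ, y = flatten z := by
  rw [Interp.domain, Formula.realize_iAnd]
  simp only [Formula.realize_sub, eval_flatProj]
  constructor
  · intro h
    exact ⟨fun k => ⟨_, h k⟩, rfl⟩
  · rintro ⟨z, rfl⟩ k
    exact (z k).2

theorem Interp.finite_flat {κ : Type} [Finite κ] (Γ : κ → L₀.Sorts) :
    Finite (Σ k, (i.obj (Γ k)).ι) :=
  have := fun k => (i.obj (Γ k)).fin
  inferInstance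

/-- Universal quantification over a tuple of elements of the interpreted structure. -/
theorem Interp.exists_all {α : Type*} {Θ : α → L.Sorts} {κ : Type} [Finite κ]
    (Γ : κ → L₀.Sorts) (φ : Formula L (Sum.elim Θ (flatSort i.obj Γ))) :
    ∃ ψ : Formula L Θ, ∀ (M : Model T) (x : Tuple M.toStruc Θ), ψ.Realize M.toStruc x ↔
      ∀ z : Tuple (i.res M).toStruc Γ, φ.Realize M.toStruc (pair x (flatten z)) := by
  have := i.finite_flat Γ
  refine ⟨Formula.all (Formula.imp ((i.domain Γ).sub Sub.snd) φ), fun M x => ?_⟩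
  simp only [Formula.realize_all, Formula.realize_imp, Formula.realize_sub, Sub.eval_snd,
    i.realize_domain]
  exact ⟨fun h z => h _ ⟨z, rfl⟩, fun h y ⟨z, hz⟩ => hz ▸ h z⟩

/-- Existential quantification over a tuple of elements of the interpreted structure. -/
theorem Interp.exists_ex {α : Type*} {Θ : α → L.Sorts} {κ : Type} [Finite κ]
    (Γ : κ → L₀.Sorts) (φ : Formula L (Sum.elim Θ (flatSort i.obj Γ))) :
    ∃ ψ : Formula L Θ, ∀ (M : Model T) (x : Tuple M.toStruc Θ), ψ.Realize M.toStruc x ↔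
      ∃ z : Tuple (i.res M).toStruc Γ, φ.Realize M.toStruc (pair x (flatten z)) := by
  obtain ⟨ψ, h⟩ := i.exists_all Γ (Formula.not φ)
  exact ⟨Formula.not ψ, fun M x => by simp [h]⟩

variable {α : Type w} {Γ : α → L₀.Sorts}

/-- Function symbols are interpreted by graphs, so a term is translated into a formula for its
graph, with the values of subterms quantified existentially over the interpreted sorts. -/
theorem Interp.exists_term_graph {Δ : List L₀.Sorts} {s : L₀.Sorts} (t : Term L₀ Γ Δ s) :
    ∃ φ : Formula L (Sum.elim (Sum.elim (flatSort i.obj Γ) (flatSort i.obj Δ.get))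
        (i.obj s).sort),
      ∀ (M : Model T) (x : Tuple (i.res M).toStruc Γ) (e : Tuple (i.res M).toStruc Δ.get)
        (y : (i.res M).carrier s),
        φ.Realize M.toStruc (pair (pair (flatten x) (flatten e)) (Subtype.val y)) ↔
          t.val (i.res M).toStruc x e = y := by
  induction t with
  | free a =>
    have := (i.obj (Γ a)).fin
    refine ⟨Formula.eqTuple ((flatProj i.obj Γ a).comp (Sub.fst.comp Sub.fst)) Sub.snd,
      fun M x e y => ?_⟩
    simp only [Formula.realize_eqTuple, Sub.eval_comp, Sub.eval_fst, Sub.eval_snd, eval_flatProj]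
    exact (Subtype.ext_iff (a1 := x a) (a2 := y)).symm
  | bound k =>
    have := (i.obj (Δ.get k)).fin
    refine ⟨Formula.eqTuple ((flatProj i.obj Δ.get k).comp (Sub.snd.comp Sub.fst)) Sub.snd,
      fun M x e y => ?_⟩
    simp only [Formula.realize_eqTuple, Sub.eval_comp, Sub.eval_fst, Sub.eval_snd, eval_flatProj]
    exact (Subtype.ext_iff (a1 := e k) (a2 := y)).symm
  | @app a s f ts ih =>
    choose φ hφ using ih
    obtain ⟨ψ, hψ⟩ := i.exists_ex (Θ := Sum.elim (Sum.elim (flatSort i.obj Γ)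
      (flatSort i.obj Δ.get)) (i.obj s).sort) a.get
      (Formula.and (Formula.iAnd fun k => (φ k).sub (Sub.pair (Sub.fst.comp Sub.fst)
        ((flatProj i.obj a.get k).comp Sub.snd)))
        ((i.graph f).sub (Sub.pair Sub.snd (Sub.snd.comp Sub.fst))))
    refine ⟨ψ, fun M x e y => (hψ M _).trans ?_⟩
    simp only [Formula.realize_and, Formula.realize_iAnd, Formula.realize_sub, Sub.eval_pair,
      Sub.eval_comp, Sub.eval_fst, Sub.eval_snd, eval_flatProj]
    have key : ∀ z : Tuple (i.res M).toStruc a.get,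
        (i.graph f).Realize M.toStruc (pair (flatten z) (Subtype.val y)) ↔
          (i.res M).funMap f z = y := fun z => i.realize_graph M f z y
    constructor
    · rintro ⟨z, h1, h2⟩
      obtain rfl : (fun k => (ts k).val (i.res M).toStruc x e) = z :=
        funext fun k => (hφ k M x e (z k)).1 (h1 k)
      exact (key _).1 h2
    · intro h
      exact ⟨fun k => (ts k).val (i.res M).toStruc x e, fun k => (hφ k M x e _).2 rfl,
        (key _).2 h⟩

theorem Interp.exists_bform {Δ : List L₀.Sorts} (ψ : BForm L₀ Γ Δ) :
    ∃ φ : Formula L (Sum.elim (flatSort i.obj Γ) (flatSort i.obj Δ.get)),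
      ∀ (M : Model T) (x : Tuple (i.res M).toStruc Γ) (e : Tuple (i.res M).toStruc Δ.get),
        φ.Realize M.toStruc (pair (flatten x) (flatten e)) ↔
          ψ.Holds (i.res M).toStruc x e := by
  induction ψ with
  | falsum => exact ⟨Formula.bot, fun _ _ _ => Iff.rfl⟩
  | @eq Δ s t₁ t₂ =>
    obtain ⟨φ₁, h₁⟩ := i.exists_term_graph t₁
    obtain ⟨φ₂, h₂⟩ := i.exists_term_graph t₂
    obtain ⟨ψ, hψ⟩ := i.exists_ex (fun _ : Unit => s)
      (Formula.and (φ₁.sub (Sub.pair Sub.fst ((flatProj i.obj (fun _ : Unit => s) ()).comp Sub.snd)))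
        (φ₂.sub (Sub.pair Sub.fst ((flatProj i.obj (fun _ : Unit => s) ()).comp Sub.snd))))
    refine ⟨ψ, fun M x e => (hψ M _).trans ?_⟩
    simp only [Formula.realize_and, Formula.realize_sub, Sub.eval_pair,
      Sub.eval_comp, Sub.eval_fst, Sub.eval_snd, eval_flatProj]
    constructor
    · rintro ⟨z, k₁, k₂⟩
      exact ((h₁ M x e (z ())).1 k₁).trans ((h₂ M x e (z ())).1 k₂).symm
    · intro h
      exact ⟨fun _ => t₁.val (i.res M).toStruc x e, (h₁ M x e _).2 rfl, (h₂ M x e _).2 h.symm⟩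
  | @rel Δ a R ts =>
    choose φ hφ using fun k => i.exists_term_graph (ts k)
    obtain ⟨ψ, hψ⟩ := i.exists_ex a.get
      (Formula.and (Formula.iAnd fun k => (φ k).sub (Sub.pair Sub.fst
        ((flatProj i.obj a.get k).comp Sub.snd)))
        ((i.rel R).sub Sub.snd))
    refine ⟨ψ, fun M x e => (hψ M _).trans ?_⟩
    simp only [Formula.realize_and, Formula.realize_iAnd, Formula.realize_sub, Sub.eval_pair,
      Sub.eval_comp, Sub.eval_fst, Sub.eval_snd, eval_flatProj]
    constructor
    · rintro ⟨z, h1, h2⟩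
      obtain rfl : (fun k => (ts k).val (i.res M).toStruc x e) = z :=
        funext fun k => (hφ k M x e (z k)).1 (h1 k)
      exact h2
    · intro h
      exact ⟨fun k => (ts k).val (i.res M).toStruc x e, fun k => (hφ k M x e _).2 rfl, h⟩
  | imp φ ψ ih₁ ih₂ =>
    obtain ⟨φ₁, h₁⟩ := ih₁
    obtain ⟨φ₂, h₂⟩ := ih₂
    exact ⟨Formula.imp φ₁ φ₂, fun M x e => imp_congr (h₁ M x e) (h₂ M x e)⟩
  | @all Δ s φ ih =>
    obtain ⟨φ, hφ⟩ := ih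
    -- The components of bound variable `0` come from the newly quantified element; the other bound
    -- variables move down by one.
    let ρ : Sub L (Sum.elim (Sum.elim (flatSort i.obj Γ) (flatSort i.obj Δ.get))
        (flatSort i.obj (fun _ : Unit => s))) (flatSort i.obj (s :: Δ).get) := fun p =>
      match p with
      | ⟨⟨0, _⟩, j⟩ => Sub.snd (Δ := flatSort i.obj (fun _ : Unit => s)) ⟨(), j⟩
      | ⟨⟨k + 1, h⟩, j⟩ =>
        ((Sub.snd (Γ := flatSort i.obj Γ) (Δ := flatSort i.obj Δ.get)).comp Sub.fst)
          ⟨⟨k, Nat.lt_of_succ_lt_succ h⟩, j⟩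
    obtain ⟨ψ, hψ⟩ := i.exists_all (fun _ : Unit => s)
      (φ.sub (Sub.pair (Sub.fst.comp Sub.fst) ρ))
    refine ⟨ψ, fun M x e => (hψ M _).trans ?_⟩
    have key : ∀ z : Tuple (i.res M).toStruc (fun _ : Unit => s),
        ρ.eval M.toStruc (pair (pair (flatten x) (flatten e)) (flatten z)) =
          flatten (consTuple (M := (i.res M).carrier) (z ()) e) := by
      intro z
      funext p
      rcases p with ⟨⟨_ | k, h⟩, j⟩ <;> rfl
    simp only [Formula.realize_sub, Sub.eval_pair, Sub.eval_comp, Sub.eval_fst, key]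
    constructor
    · intro h b
      exact (hφ M x _).1 (h fun _ => b)
    · intro h z
      exact (hφ M x _).2 (h (z ()))

/-- A formula of `L₀` about the interpreted structure is a formula of `L`. -/
theorem Interp.exists_formula (ψ : Formula L₀ Γ) :
    ∃ φ : Formula L (flatSort i.obj Γ), ∀ (M : Model T) (x : Tuple (i.res M).toStruc Γ),
      φ.Realize M.toStruc (flatten x) ↔ ψ.Realize (i.res M).toStruc x := by
  obtain ⟨φ, h⟩ := i.exists_bform ψ
  refine ⟨φ.sub (Sub.pair Sub.id (fun p => p.1.elim0)), fun M x => ?_⟩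
  rw [Formula.realize_sub, Sub.eval_pair, Sub.eval_id]
  refine Iff.trans ?_ (h M x nilPi)
  refine iff_of_eq (congrArg (fun y => φ.Realize M.toStruc (pair (flatten x) y)) ?_)
  funext p
  exact p.1.elim0

end Translation
end ManySorted

namespace ManySorted

variable {L : Lang.{u}} {T : Theory L}

/-! ### Ultrapowers -/

section Ultrapower

variable {J : Type u} (U : Ultrafilter J) (M : Struc L)

/-- The ultrapower of a structure. -/
noncomputable def ultrapower : Struc L where
  carrier s := Filter.Germ (U : Filter J) (M s)
  funMap f x := ((fun F => M.funMap f fun k => (x k).out F : J → M _) : Filter.Germ _ _)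
  relMap R x := ∀ᶠ F in U, M.relMap R fun k => (x k).out F

variable {M}

/-- The tuple of classes of a sequence of tuples. -/
def ultraTuple {α : Type w} {Γ : α → L.Sorts} (x : J → Tuple M Γ) :
    Tuple (ultrapower U M) Γ :=
  fun a => ((fun F => x F a : J → M (Γ a)) : Filter.Germ (U : Filter J) (M (Γ a)))

/-- The structure on the ultrapower is defined by chosen representatives. A symbol has finitely many
arguments, so these agree with any given representatives on a common large set. -/
theorem eventually_out {a : List L.Sorts} (x : J → Tuple M a.get) :
    ∀ᶠ F in (U : Filter J), (fun k => Quotient.out (ultraTuple U x k) F : Tuple M a.get) = x F := by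
  have h : ∀ k, ∀ᶠ F in (U : Filter J), Quotient.out (ultraTuple U x k) F = x F k := fun k =>
    Filter.Germ.coe_eq.1 (Quotient.out_eq (ultraTuple U x k))
  filter_upwards [Filter.eventually_all.2 h] with F hF
  exact funext hF

theorem val_ultrapower {α : Type w} {Γ : α → L.Sorts} {Δ : List L.Sorts} (x : J → Tuple M Γ)
    (e : J → Tuple M Δ.get) {s : L.Sorts} (t : Term L Γ Δ s) :
    t.val (ultrapower U M) (ultraTuple U x) (ultraTuple U e) =
      ((fun F => t.val M (x F) (e F) : J → M s) : Filter.Germ (U : Filter J) (M s)) := by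
  induction t with
  | free a => rfl
  | bound k => rfl
  | app f ts ih =>
    refine (congrArg ((ultrapower U M).funMap f) (funext ih)).trans ?_
    refine Filter.Germ.coe_eq.2 ?_
    filter_upwards [eventually_out U fun F k => (ts k).val M (x F) (e F)] with F hF
    exact congrArg (M.funMap f) hF

theorem holds_ultrapower {α : Type w} {Γ : α → L.Sorts} {Δ : List L.Sorts} (φ : BForm L Γ Δ)
    (x : J → Tuple M Γ) : ∀ (e : J → Tuple M Δ.get),
    φ.Holds (ultrapower U M) (ultraTuple U x) (ultraTuple U e) ↔
      ∀ᶠ F in (U : Filter J), φ.Holds M (x F) (e F) := by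
  induction φ with
  | falsum =>
    intro e
    simp [BForm.Holds, U.neBot.ne]
  | eq t₁ t₂ =>
    intro e
    simp only [BForm.Holds, val_ultrapower]
    exact Filter.Germ.coe_eq
  | rel R ts =>
    intro e
    simp only [BForm.Holds, val_ultrapower]
    refine Filter.eventually_congr ?_
    filter_upwards [eventually_out U fun F k => (ts k).val M (x F) (e F)] with F hF
    exact iff_of_eq (congrArg (M.relMap R) hF)
  | imp φ ψ ih₁ ih₂ =>
    intro e
    simp only [BForm.Holds, ih₁, ih₂, Ultrafilter.eventually_imp]
  | @all Δ s φ ih =>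
    intro e
    have hcons : ∀ b : J → M s, consTuple (M := (ultrapower U M).carrier)
        (b : Filter.Germ (U : Filter J) (M s)) (ultraTuple U e) =
          ultraTuple U (fun F => consTuple (b F) (e F)) := by
      intro b
      funext k
      rcases k with ⟨_ | k, h⟩ <;> rfl
    simp only [BForm.Holds]
    constructor
    · intro h
      by_contra h'
      rw [← Ultrafilter.eventually_not] at h'
      simp only [not_forall] at h'
      -- Sorts may be empty, so the default value `b₀` is taken from an index at which a
      -- counterexample exists.
      obtain ⟨F₀, b₀, -⟩ := h'.exists
      have hb : ∀ F, ∃ b : M s, (∃ b, ¬ φ.Holds M (x F) (consTuple b (e F))) →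
          ¬ φ.Holds M (x F) (consTuple b (e F)) := by
        intro F
        by_cases hF : ∃ b, ¬ φ.Holds M (x F) (consTuple b (e F))
        · exact ⟨hF.choose, fun _ => hF.choose_spec⟩
        · exact ⟨b₀, fun h => absurd h hF⟩
      choose b hb using hb
      have h1 := h (b : Filter.Germ (U : Filter J) (M s))
      rw [hcons, ih] at h1
      obtain ⟨F, hF1, hF2⟩ := (h1.and h').exists
      exact hb F hF2 hF1
    · intro h b
      induction b using Filter.Germ.inductionOn with | _ b => ?_
      rw [hcons, ih]
      exact h.mono fun F hF => hF _

/-- The theorem of Łoś, for ultrapowers. -/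
theorem realize_ultrapower {α : Type w} {Γ : α → L.Sorts} (φ : Formula L Γ)
    (x : J → Tuple M Γ) : φ.Realize (ultrapower U M) (ultraTuple U x) ↔
      ∀ᶠ F in (U : Filter J), φ.Realize M (x F) := by
  refine Iff.trans (iff_of_eq (congrArg (fun e => BForm.Holds _ _ φ e) ?_))
    (holds_ultrapower U φ x (fun F => nilPi))
  exact (eq_nilPi _).trans (eq_nilPi _).symm

theorem ultraTuple_pair {α β : Type*} {Γ : α → L.Sorts} {Δ : β → L.Sorts}
    (x : J → Tuple M Γ) (y : J → Tuple M Δ) :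
    pair (ultraTuple U x) (ultraTuple U y) = ultraTuple U (fun F => pair (x F) (y F)) := by
  funext k
  cases k <;> rfl

/-- The ultrapower of a model. -/
noncomputable def ultraModel (M : Model T) : Model T where
  toStruc := ultrapower U M.toStruc
  isModel φ hφ := by
    have h := (realize_ultrapower U φ (fun _ : J => fun a : Empty => a.elim)).2
      (Filter.Eventually.of_forall fun _ => M.isModel φ hφ)
    convert h using 1

/-- The class of a sequence of points of a definable set. -/
def ultraPt (M : Model T) {X : DefSet L} (x : J → X.pts M.toStruc) :
    X.pts (ultraModel U M).toStruc :=
  ⟨ultraTuple U (fun F => (x F).1),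
    (realize_ultrapower U _ _).2 (Filter.Eventually.of_forall fun F => (x F).2)⟩

theorem eventually_eq_of_ultraPt_eq (M : Model T) {X : DefSet L} {x y : J → X.pts M.toStruc}
    (h : ultraPt U M x = ultraPt U M y) : ∀ᶠ F in (U : Filter J), x F = y F := by
  have := X.fin
  have h : ∀ k, ∀ᶠ F in (U : Filter J), (x F).1 k = (y F).1 k := fun k =>
    Filter.Germ.coe_eq.1 (congrFun (congrArg Subtype.val h) k)
  filter_upwards [Filter.eventually_all.2 h] with F hF
  exact Subtype.ext (funext hF)

theorem isElementary_diagonal (M : Model T) (A : Subsets M.toStruc)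
    {f : ∀ s, A s → M.carrier s} (hf : IsElementary M.toStruc M.toStruc A f) :
    IsElementary M.toStruc (ultraModel U M).toStruc A
      (fun s a => ((fun _ => f s a : J → M.carrier s) : Filter.Germ (U : Filter J) (M.carrier s))) := by
  intro Q x
  refine (hf Q x).trans (Iff.trans ?_ (realize_ultrapower U Q.form
    (fun _ : J => fun k => f _ (x k))).symm)
  exact Filter.eventually_const.symm

end Ultrapower

end ManySorted

namespace ManySorted

variable {L₀ L : Lang.{u}} {T₀ : Theory L₀} {T : Theory L}

/-! ### Types over the interpreted structure -/

/-- Canonical parameters, in the interpreted structure, of a definable family. -/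
theorem Interp.StablyEmbedded.exists_canonical {i : Interp T₀ T} (hi : i.StablyEmbedded)
    (hEI : T₀.ElimImaginaries) {ι κ : Type} [Finite ι] [Finite κ] {Γ : ι → L.Sorts}
    {Γ₀ : κ → L₀.Sorts} (φ : Formula L (Sum.elim Γ (flatSort i.obj Γ₀))) :
    ∃ (μ : Type) (_ : Finite μ) (Γ' : μ → L₀.Sorts) (D : Formula L₀ Γ')
      (Z : Formula L₀ (Sum.elim Γ' Γ₀)), ∀ (M : Model T) (x : Tuple M.toStruc Γ),
        ∃! v : Tuple (i.res M).toStruc Γ', D.Realize (i.res M).toStruc v ∧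
          ∀ y : Tuple (i.res M).toStruc Γ₀, φ.Realize M.toStruc (pair x (flatten y)) ↔
            Z.Realize (i.res M).toStruc (pair v y) := by
  obtain ⟨ν, _, Δ₀, Z₀, hZ₀⟩ := hi ι κ Γ Γ₀ φ
  let X : DefSet L₀ := ⟨ν, Δ₀, Formula.top⟩
  -- Two parameters are equivalent when they define the same fibre of `Z₀`; the class of `w` is the
  -- canonical parameter.
  let E : Formula L₀ (Sum.elim X.sort X.sort) := Formula.all (Formula.iff
    (Z₀.sub (Sub.pair (Sub.fst.comp Sub.fst) Sub.snd))
    (Z₀.sub (Sub.pair (Sub.snd.comp Sub.fst) Sub.snd)))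
  have hE : ∀ (N : Struc L₀) (w w' : Tuple N Δ₀), E.Realize N (pair w w') ↔
      ∀ y : Tuple N Γ₀, Z₀.Realize N (pair w y) ↔ Z₀.Realize N (pair w' y) := by
    intro N w w'
    simp [E, X]
  obtain ⟨μ, _, Γ', F, hF⟩ := hEI X E fun N => by
    refine ⟨fun w => ?_, fun {w w'} h => ?_, fun {w w' w''} h h' => ?_⟩
    · rw [hE]; exact fun _ => Iff.rfl
    · rw [hE] at h ⊢; exact fun y => (h y).symm
    · rw [hE] at h h' ⊢; exact fun y => (h y).trans (h' y)
  -- `D` says that `v` is the code of some `w`, and `Z` tests membership through such a `w`. Without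
  -- `D`, any `v` that is not a code would define the empty set, which could spoil uniqueness.
  refine ⟨μ, inferInstance, Γ',
    Formula.ex (F.sub (Sub.pair Sub.snd Sub.fst)),
    Formula.ex (Formula.and (F.sub (Sub.pair Sub.snd (Sub.fst.comp Sub.fst)))
      (Z₀.sub (Sub.pair Sub.snd (Sub.snd.comp Sub.fst)))), fun M x => ?_⟩
  obtain ⟨f, hf, hfE⟩ := hF (i.res M)
  obtain ⟨w, hw⟩ := hZ₀ M x
  simp only [Formula.realize_ex, Formula.realize_and, Formula.realize_sub, Sub.eval_pair,
    Sub.eval_comp, Sub.eval_fst, Sub.eval_snd]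
  let p : Tuple (i.res M).toStruc Δ₀ → X.pts (i.res M).toStruc := fun w =>
    ⟨w, (Formula.realize_top _ _).2 trivial⟩
  have hp : ∀ w w', f (p w) = f (p w') ↔ ∀ y : Tuple (i.res M).toStruc Γ₀,
      Z₀.Realize _ (pair w y) ↔ Z₀.Realize _ (pair w' y) := fun w w' =>
    (hfE (p w) (p w')).symm.trans (hE _ w w')
  have hZ : ∀ w' (y : Tuple (i.res M).toStruc Γ₀),
      (∃ z, F.Realize (i.res M).toStruc (pair z (f (p w'))) ∧
        Z₀.Realize (i.res M).toStruc (pair z y)) ↔ Z₀.Realize (i.res M).toStruc (pair w' y) := by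
    intro w' y
    constructor
    · rintro ⟨z, h1, h2⟩
      exact ((hp z w').1 ((hf (p z) _).2 h1) y).1 h2
    · intro h
      exact ⟨w', (hf (p w') _).1 rfl, h⟩
  refine ⟨f (p w), ⟨⟨w, (hf (p w) _).1 rfl⟩, fun y => (hw y).trans (hZ w y).symm⟩, ?_⟩
  rintro v ⟨⟨w', hw'⟩, h⟩
  obtain rfl := (hf (p w') v).2 hw'
  exact (hp w' w).2 fun y => ((hZ w' y).symm.trans (h y).symm).trans (hw y)

/-- An elementary map that fixes the elements of the interpreted structure in a definably closed
set `A` preserves the type of tuples from `A` over the interpreted structure. -/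
theorem Interp.StablyEmbedded.realize_iff {i : Interp T₀ T} (hi : i.StablyEmbedded)
    (hEI : T₀.ElimImaginaries) {M : Model T} {A B : Subsets M.toStruc}
    (hA : IsDefClosed M.toStruc A) (hAB : A ≤ B) {f : ∀ s, B s → M.carrier s}
    (hf : IsElementary M.toStruc M.toStruc B f)
    (hfix : ∀ s (b : B s), b.1 ∈ i.inj M (i.restrict M A) s → f s b = b.1)
    {ι κ : Type} [Finite ι] [Finite κ] {Γ : ι → L.Sorts} {Γ₀ : κ → L₀.Sorts}
    (φ : Formula L (Sum.elim Γ (flatSort i.obj Γ₀))) (a : ∀ k, A (Γ k))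
    (y : Tuple (i.res M).toStruc Γ₀) :
    φ.Realize M.toStruc (pair (fun k => (a k).1) (flatten y)) ↔
      φ.Realize M.toStruc (pair (fun k => f _ ⟨(a k).1, hAB _ (a k).2⟩) (flatten y)) := by
  obtain ⟨μ, _, Γ', D, Z, h⟩ := hi.exists_canonical hEI φ
  obtain ⟨D', hD'⟩ := i.exists_formula D
  obtain ⟨Z', hZ'⟩ := i.exists_formula Z
  let ρ : Sub L (Sum.elim (Sum.elim Γ (flatSort i.obj Γ')) (flatSort i.obj Γ₀))
      (flatSort i.obj (Sum.elim Γ' Γ₀)) := fun p => match p with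
    | ⟨Sum.inl k, j⟩ => (Sub.snd (Γ := Γ) (Δ := flatSort i.obj Γ')).comp Sub.fst ⟨k, j⟩
    | ⟨Sum.inr k, j⟩ => Sub.snd (Δ := flatSort i.obj Γ₀) ⟨k, j⟩
  have hρ : ∀ (x : Tuple M.toStruc Γ) (v : Tuple (i.res M).toStruc Γ')
      (y : Tuple (i.res M).toStruc Γ₀),
      ρ.eval M.toStruc (pair (pair x (flatten v)) (flatten y)) = flatten (pair v y) := by
    intro x v y
    funext p
    rcases p with ⟨k | k, j⟩ <;> rfl
  obtain ⟨Ψ, hΨ⟩ := i.exists_all Γ₀ (Θ := Sum.elim Γ (flatSort i.obj Γ'))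
    (Formula.iff (φ.sub (Sub.pair (Sub.fst.comp Sub.fst) Sub.snd)) (Z'.sub ρ))
  -- `Θ(x, v)` expresses in `L` that `v` is the canonical parameter of `φ(x, ·)`.
  let Θ := Formula.and (D'.sub Sub.snd) Ψ
  have hΘ : ∀ (x : Tuple M.toStruc Γ) (v : Tuple (i.res M).toStruc Γ'),
      Θ.Realize M.toStruc (pair x (flatten v)) ↔ D.Realize (i.res M).toStruc v ∧
        ∀ y : Tuple (i.res M).toStruc Γ₀, φ.Realize M.toStruc (pair x (flatten y)) ↔
          Z.Realize (i.res M).toStruc (pair v y) := by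
    intro x v
    simp only [Θ, Formula.realize_and, Formula.realize_sub, Sub.eval_snd, hD', hΨ,
      Formula.realize_iff, Sub.eval_pair, Sub.eval_comp, Sub.eval_fst, hρ, hZ']
  obtain ⟨v, hv, hv'⟩ := h M (fun k => (a k).1)
  have := i.finite_flat Γ'
  -- Uniqueness of the canonical parameter makes it definable from `a`.
  have hvA : ∀ p, flatten (obj := i.obj) (M := M.toStruc) v p ∈ A (flatSort i.obj Γ' p) := by
    let X : DefSet L := ⟨_, flatSort i.obj Γ', i.domain Γ'⟩
    refine hA.mem_of_formula (X := X) ⟨flatten v, (i.realize_domain Γ' M _).2 ⟨v, rfl⟩⟩ Θ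
      (fun k => (a k).1) (fun k => (a k).2) ?_
    rintro ⟨y, hy⟩
    obtain ⟨v', rfl⟩ := (i.realize_domain Γ' M y).1 hy
    refine (hΘ _ v').trans ⟨fun h' => ?_, fun h' => ?_⟩
    · obtain rfl := hv' v' h'
      rfl
    · have h1 := congrArg Subtype.val h'
      have : v' = v := funext fun k => Subtype.ext (funext fun j => congrFun h1 ⟨k, j⟩)
      rw [this]
      exact hv
  -- Applying `f` to `Θ(a, v)`, and using that `f` fixes `v`, shows that `v` also codes `φ(f a, ·)`.
  have h1 := (hΘ _ v).2 hv
  rw [hf.realize_pair Θ (fun k => ⟨(a k).1, hAB _ (a k).2⟩)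
    (fun p => ⟨flatten (obj := i.obj) (M := M.toStruc) v p, hAB _ (hvA p)⟩)] at h1
  have h2 : (fun p => f _ ⟨flatten (obj := i.obj) (M := M.toStruc) v p, hAB _ (hvA p)⟩) =
      flatten v :=
    funext fun p => hfix _ _ ⟨Γ' p.1, v p.1, fun j => hvA ⟨p.1, j⟩, p.2, rfl⟩
  rw [h2, hΘ] at h1
  exact (hv.2 y).trans (h1.2 y).symm

/-- The tuple of all elements of the interpreted structure. -/
def Interp.tautTuple (i : Interp T₀ T) (M : Model T) :
    Tuple M.toStruc (flatSort i.obj (fun d : (Σ s₀, (i.obj s₀).pts M.toStruc) => d.1)) :=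
  flatten (fun d => d.2)

/-- This compares the types of `A` and `f A` over all of `M₀`. A formula may mention only some
components of an element of `M₀`, so whole elements are supplied and projected by `ρ`. -/
theorem Interp.StablyEmbedded.realize_taut_iff {i : Interp T₀ T} (hi : i.StablyEmbedded)
    (hEI : T₀.ElimImaginaries) {M : Model T} {A B : Subsets M.toStruc}
    (hA : IsDefClosed M.toStruc A) (hAB : A ≤ B) {f : ∀ s, B s → M.carrier s}
    (hf : IsElementary M.toStruc M.toStruc B f)
    (hfix : ∀ s (b : B s), b.1 ∈ i.inj M (i.restrict M A) s → f s b = b.1)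
    (φ : Formula L (Sum.elim (fun a : (Σ t, A t) => a.1)
      (flatSort i.obj (fun d : (Σ s₀, (i.obj s₀).pts M.toStruc) => d.1)))) :
    φ.Realize M.toStruc (pair (fun a => a.2.1) (i.tautTuple M)) ↔
      φ.Realize M.toStruc (pair (fun a => f _ ⟨a.2.1, hAB _ a.2.2⟩) (i.tautTuple M)) := by
  obtain ⟨ι, κ, _, _, g, h, φ', hφ⟩ := φ.exists_support_pair
  rw [hφ, hφ]
  let ρ : Sub L (flatSort i.obj (fun k => (h k).1.1))
      (fun k => flatSort i.obj (fun d : (Σ s₀, (i.obj s₀).pts M.toStruc) => d.1) (h k)) :=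
    fun k => Sub.id (Γ := flatSort i.obj (fun k => (h k).1.1)) ⟨k, (h k).2⟩
  have key := hi.realize_iff hEI hA hAB hf hfix (φ'.sub (Sub.pair Sub.fst (ρ.comp Sub.snd)))
    (fun k => (g k).2) (fun k => (h k).1.2)
  simp only [Formula.realize_sub, Sub.eval_pair, Sub.eval_comp, Sub.eval_fst,
    Sub.eval_snd] at key
  exact key

/-- A tuple such that its definable closure is everything generates. -/
theorem generates_of_dcl {M : Struc L} {C : Subsets M} (h : ∀ s, dcl M C s = Set.univ)
    {α : Type*} {Γ : α → L.Sorts} (c : Tuple M Γ)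
    (hc : ∀ s, ∀ b ∈ C s, ∃ a, (⟨Γ a, c a⟩ : Σ t, M t) = ⟨s, b⟩) : Generates M c := by
  intro s b
  obtain ⟨φ, hφ⟩ : b ∈ dcl M C s := h s ▸ Set.mem_univ b
  have ht : ∀ a : (Σ t, C t), ∃ t : Term L Γ [] a.1, t.val M c nilPi = a.2.1 := by
    rintro ⟨t, x, hx⟩
    obtain ⟨a, ha⟩ := hc t x hx
    have key : ∀ p : (Σ t, M t), ⟨Γ a, c a⟩ = p → ∃ t : Term L Γ [] p.1,
        t.val M c nilPi = p.2 := by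
      rintro _ rfl
      exact ⟨Sub.id a, rfl⟩
    exact key _ ha
  choose ρ hρ using ht
  refine ⟨φ.sub (Sub.pair (Sub.comp ρ Sub.fst) Sub.snd), fun y => ?_⟩
  have : Sub.eval M ρ c = fun a => a.2.1 := funext hρ
  simp only [Formula.realize_sub, Sub.eval_pair, Sub.eval_comp, Sub.eval_fst, Sub.eval_snd, this]
  exact hφ y

/-- An elementary map that fixes the elements of the interpreted structure in a set `A` of
internality parameters agrees on `A` with an automorphism over the interpreted structure. -/
theorem Interp.IsInternalityParams.exists_isAut {i : Interp T₀ T} {M : Model T}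
    {A B : Subsets M.toStruc} (hA : i.IsInternalityParams M A) (hi : i.StablyEmbedded)
    (hEI : T₀.ElimImaginaries) (hAB : A ≤ B) {f : ∀ s, B s → M.carrier s}
    (hf : IsElementary M.toStruc M.toStruc B f)
    (hfix : ∀ s (b : B s), b.1 ∈ i.inj M (i.restrict M A) s → f s b = b.1) :
    ∃ τ : ∀ s, Equiv.Perm (M.carrier s), IsAut M.toStruc τ ∧
      (∀ s, ∀ b ∈ i.inj M (fun _ => Set.univ) s, τ s b = b) ∧
      ∀ s (b : M.carrier s) (hb : b ∈ A s), τ s b = f s ⟨b, hAB s hb⟩ := by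
  -- Internality is used with `N = M` and an arbitrary elementary `j`, so that it covers both the
  -- inclusion of `A` and `f`.
  have gen : ∀ j : ∀ s, A s → M.carrier s, IsElementary M.toStruc M.toStruc A j →
      Generates M.toStruc (pair (fun a : (Σ t, A t) => j a.1 a.2) (i.tautTuple M)) := by
    intro j hj
    refine generates_of_dcl (hA.2 M j hj) _ ?_
    rintro s b (⟨s₀, x, -, k, hk⟩ | ⟨a, rfl⟩)
    · exact ⟨Sum.inr ⟨⟨s₀, x⟩, k⟩, hk⟩
    · exact ⟨Sum.inl ⟨s, a⟩, rfl⟩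
  obtain ⟨τ, hτ, hτc⟩ := ManySorted.exists_isAut (hi.realize_taut_iff hEI hA.1 hAB hf hfix)
    (gen (fun s a => a.1) fun _ _ => Iff.rfl)
    (gen (fun s a => f s ⟨a.1, hAB s a.2⟩) fun Q x => hf Q fun k => ⟨(x k).1, hAB _ (x k).2⟩)
  refine ⟨τ, hτ, ?_, fun s b hb => hτc (Sum.inl ⟨s, b, hb⟩)⟩
  rintro s b ⟨s₀, x, -, k, hk⟩
  have key : ∀ p : (Σ t, M.carrier t), ⟨(i.obj s₀).sort k, x.1 k⟩ = p → τ p.1 p.2 = p.2 := by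
    rintro _ rfl
    exact hτc (Sum.inr ⟨⟨s₀, x⟩, k⟩)
  exact key _ hk

end ManySorted

namespace ManySorted

variable {L₀ L : Lang.{u}} {T₀ : Theory L₀} {T : Theory L}

/-! ### The Galois pro-group -/

/-- The definable set of all elements of a sort. -/
def sortSet (s : L.Sorts) : DefSet L := ⟨Unit, fun _ => s, Formula.top⟩

/-- An element of a sort, as a point of a definable set. -/
def sortPt (M : Struc L) {s : L.Sorts} (b : M s) : (sortSet s).pts M :=
  ⟨fun _ => b, (Formula.realize_top _ _).2 trivial⟩

variable {G : ProGroup T} {m : G.Action}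

/-- `E` identifies `G(M)` with `Aut(M/M₀)`, through the action. -/
structure IsGaloisHom (i : Interp T₀ T) (m : G.Action) (M : Model T)
    (E : G.pts M →* (∀ s, Equiv.Perm (M.carrier s))) : Prop where
  injective : Function.Injective E
  isAut : ∀ g, IsAut M.toStruc (E g)
  fixes : ∀ g s, ∀ b ∈ i.inj M (fun _ => Set.univ) s, E g s b = b
  surj : ∀ τ, IsAut M.toStruc τ → (∀ s, ∀ b ∈ i.inj M (fun _ => Set.univ) s, τ s b = b) →
    ∃ g, E g = τ
  apply_eq : ∀ (g : G.pts M) (Q : DefSet L) (x : Q.pts M.toStruc) (j : Q.ι),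
    (m.apply g Q x).1 j = E g (Q.sort j) (x.1 j)

/-- For the full set of elements the subgroup in `IdentifiesWithAut` is all of `G(M)`, and
permutations of `Set.univ` become permutations of the sorts. -/
theorem ProGroup.Action.IsGalois.exists_hom {i : Interp T₀ T} (hG : m.IsGalois i) (M : Model T) :
    ∃ E, IsGaloisHom i m M E := by
  obtain ⟨GB, hGB, e, he⟩ := hG M
  have hmem : ∀ g, g ∈ GB := fun g => (hGB g).2 fun _ _ => trivial
  let E : G.pts M →* (∀ s, Equiv.Perm (M.carrier s)) :=
    { toFun := fun g s => (Equiv.Set.univ _).permCongr ((e ⟨g, hmem g⟩).1 s)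
      map_one' := by
        have h1 : (⟨1, hmem 1⟩ : GB) = 1 := rfl
        funext s
        rw [h1, map_one]
        rfl
      map_mul' := fun g g' => by
        have h1 : (⟨g * g', hmem _⟩ : GB) = ⟨g, hmem g⟩ * ⟨g', hmem g'⟩ := rfl
        funext s
        rw [h1, map_mul]
        rfl }
  have hE : ∀ g s b, E g s b = ((e ⟨g, hmem g⟩).1 s ⟨b, trivial⟩).1 := fun _ _ _ => rfl
  refine ⟨E, fun g g' h => ?_, fun g Q x => ?_, fun g s b hb => ?_, fun τ h1 h2 => ?_,
    fun g Q x j => he ⟨g, hmem g⟩ Q x (fun _ => trivial) j⟩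
  · have : e ⟨g, hmem g⟩ = e ⟨g', hmem g'⟩ := by
      refine Subtype.ext (funext fun s => Equiv.ext fun b => Subtype.ext ?_)
      exact congrFun (congrArg DFunLike.coe (congrFun h s)) b.1
    exact congrArg Subtype.val (e.injective this)
  · exact (e ⟨g, hmem g⟩).2.1 Q (fun j => ⟨x j, trivial⟩)
  · exact congrArg Subtype.val ((e ⟨g, hmem g⟩).2.2 s ⟨b, trivial⟩ hb)
  · let τ' : autGroup M.toStruc (fun _ => Set.univ) (i.inj M (fun _ => Set.univ)) :=
      ⟨fun s => (Equiv.Set.univ _).symm.permCongr (τ s),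
        fun Q x => h1 Q (fun j => (x j).1), fun s b hb => Subtype.ext (h2 s b.1 hb)⟩
    refine ⟨(e.symm τ').1, funext fun s => Equiv.ext fun b => ?_⟩
    have h3 : e ⟨(e.symm τ').1, hmem _⟩ = τ' := e.apply_symm_apply τ'
    rw [hE, h3]
    rfl

theorem IsGaloisHom.smul_sortPt {i : Interp T₀ T} {M : Model T}
    {E : G.pts M →* (∀ s, Equiv.Perm (M.carrier s))} (hE : IsGaloisHom i m M E) (g : G.pts M)
    {s : L.Sorts} (b : M.carrier s) :
    (m.act (sortSet s) M).smul (g.1 (m.idx (sortSet s))) (sortPt M.toStruc b) =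
      sortPt M.toStruc (E g s b) :=
  Subtype.ext (funext fun j => hE.apply_eq g (sortSet s) (sortPt M.toStruc b) j)

/-- Actions on different definable sets factor through different groups of the system. Pulling them
back to a common index `l` lets one formula about one element of `G_l` speak of several of them. -/
theorem ProGroup.Action.exists_act_formula (m : G.Action) (Q : DefSet L) {l : G.I}
    (h : m.idx Q ≤ l) :
    ∃ χ : Formula L (Sum.elim (Sum.elim (G.grp l).sort Q.sort) Q.sort),
      ∀ (M : Model T) (x : (G.grp l).pts M) (a b : Q.pts M.toStruc),
        (m.act Q M).smul (G.map h M x) a = b ↔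
          χ.Realize M.toStruc (pair (pair x.1 a.1) b.1) := by
  obtain ⟨φ, hφ⟩ := m.act_def Q
  obtain ⟨ψ, hψ⟩ := G.map_def h
  have := (G.grp (m.idx Q)).fin
  refine ⟨Formula.ex (Δ := (G.grp (m.idx Q)).sort) (Formula.and
    ((G.grp (m.idx Q)).form.sub Sub.snd) (Formula.and
      (ψ.sub (Sub.pair (Sub.fst.comp (Sub.fst.comp Sub.fst)) Sub.snd))
      (φ.sub (Sub.pair (Sub.pair Sub.snd (Sub.snd.comp (Sub.fst.comp Sub.fst)))
        (Sub.snd.comp Sub.fst))))), fun M x a b => ?_⟩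
  simp only [Formula.realize_ex, Formula.realize_and, Formula.realize_sub, Sub.eval_pair,
    Sub.eval_comp, Sub.eval_fst, Sub.eval_snd]
  constructor
  · intro h'
    exact ⟨(G.map h M x).1, (G.map h M x).2, (hψ M x _).1 rfl, (hφ M _ a b).1 h'⟩
  · rintro ⟨z, hz, h1, h2⟩
    rw [(hψ M x ⟨z, hz⟩).2 h1]
    exact (hφ M ⟨z, hz⟩ a b).2 h2

instance (G : ProGroup T) : IsDirectedOrder G.I := ⟨G.directed⟩

/-- If a coordinate of `g` is not in `B`, the finitely many conditions saying that `g` maps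
elements of `B` to elements of `B` do not determine it. -/
theorem exists_ne_of_notMem {i : Interp T₀ T} {M : Model T}
    {E : G.pts M →* (∀ s, Equiv.Perm (M.carrier s))} (hE : IsGaloisHom i m M E)
    {A B : Subsets M.toStruc} (hB : IsDefClosed M.toStruc B) (hAB : A ≤ B) (g : G.pts M)
    (hg : ∀ s, ∀ a ∈ A s, E g s a ∈ B s) {k : G.I} {j : (G.grp k).ι}
    (hk : (g.1 k).1 j ∉ B ((G.grp k).sort j)) (S : Finset (Σ s, A s)) {l : G.I} (hkl : k ≤ l)
    (hl : ∀ p : S, m.idx (sortSet p.1.1) ≤ l) :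
    ∃ x : (G.grp l).pts M, G.map hkl M x ≠ g.1 k ∧
      ∀ p : S, (m.act (sortSet p.1.1) M).smul (G.map (hl p) M x) (sortPt M.toStruc p.1.2.1) =
        sortPt M.toStruc (E g p.1.1 p.1.2.1) := by
  by_contra! hcon
  refine hk ?_
  obtain ⟨ψ, hψ⟩ := G.map_def hkl
  choose χ hχ using fun p : S => m.exists_act_formula (sortSet p.1.1) (hl p)
  have := (G.grp l).fin
  let Γ : S → L.Sorts := fun p => p.1.1
  let ρ : ∀ p : S, Sub L (Sum.elim (Sum.elim (Sum.elim Γ Γ) (G.grp k).sort) (G.grp l).sort)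
      (Sum.elim (Sum.elim (G.grp l).sort (sortSet p.1.1).sort) (sortSet p.1.1).sort) := fun p =>
    Sub.pair (Sub.pair Sub.snd (fun _ => Sub.fst.comp (Sub.fst.comp Sub.fst) p))
      (fun _ => Sub.snd.comp (Sub.fst.comp Sub.fst) p)
  have hρ : ∀ p a b y x, (ρ p).eval M.toStruc (pair (pair (pair a b) y) x) =
      pair (pair x (sortPt M.toStruc (a p)).1) (sortPt M.toStruc (b p)).1 := by
    intro p a b y x
    funext q
    rcases q with (q | q) | q <;> rfl
  -- `φ(a, b, y)` says that some `x ∈ G_l` lies over `y` and sends each `a p` to `b p`. With `b = g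
  -- a`, the assumption `hcon` leaves `g_k` as its only solution, over parameters from `B`.
  let φ : Formula L (Sum.elim (Sum.elim Γ Γ) (G.grp k).sort) :=
    Formula.ex (Δ := (G.grp l).sort) (Formula.and ((G.grp l).form.sub Sub.snd) (Formula.and
      (ψ.sub (Sub.pair Sub.snd (Sub.snd.comp Sub.fst)))
      (Formula.iAnd fun p : S => (χ p).sub (ρ p))))
  refine hB.mem_of_formula (X := (G.grp k).toDefSet) (g.1 k) φ
    (pair (fun p : S => p.1.2.1) (fun p : S => E g p.1.1 p.1.2.1)) ?_ (fun y => ?_) j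
  · rintro (p | p)
    · exact hAB _ p.1.2.2
    · exact hg _ _ p.1.2.2
  have hφ : φ.Realize M.toStruc
      (pair (pair (fun p : S => p.1.2.1) (fun p : S => E g p.1.1 p.1.2.1)) y.1) ↔
      ∃ x : (G.grp l).pts M, G.map hkl M x = y ∧ ∀ p : S,
        (m.act (sortSet p.1.1) M).smul (G.map (hl p) M x) (sortPt M.toStruc p.1.2.1) =
          sortPt M.toStruc (E g p.1.1 p.1.2.1) := by
    simp only [φ, Formula.realize_ex, Formula.realize_and, Formula.realize_iAnd,
      Formula.realize_sub, Sub.eval_pair, Sub.eval_comp, Sub.eval_fst, Sub.eval_snd, hρ]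
    constructor
    · rintro ⟨x, hx, h1, h2⟩
      exact ⟨⟨x, hx⟩, (hψ M _ y).2 h1, fun p => (hχ p M ⟨x, hx⟩ _ _).2 (h2 p)⟩
    · rintro ⟨x, h1, h2⟩
      exact ⟨x.1, x.2, (hψ M x y).1 h1, fun p => (hχ p M x _ _).1 (h2 p)⟩
  rw [hφ]
  constructor
  · rintro ⟨x, rfl, h⟩
    by_contra hne
    obtain ⟨p, hp⟩ := hcon x hne
    exact hp (h p)
  · rintro rfl
    refine ⟨g.1 l, g.2 _ _ _, fun p => ?_⟩
    rw [g.2]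
    exact hE.smul_sortPt g _

/-- The maps in `M` and in its ultrapower are related only through the common formula for their
graphs, to which the theorem of Łoś applies. -/
theorem map_ultraPt {J : Type u} (U : Ultrafilter J) (M : Model T) {a b : G.I} (h : a ≤ b)
    (x : J → (G.grp b).pts M) (y : J → (G.grp a).pts M)
    (hxy : ∀ᶠ F in (U : Filter J), G.map h M (x F) = y F) :
    G.map h (ultraModel U M) (ultraPt U M (X := (G.grp b).toDefSet) x) =
      ultraPt U M (X := (G.grp a).toDefSet) y := by
  obtain ⟨ψ, hψ⟩ := G.map_def h
  refine (hψ _ _ _).2 ?_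
  change ψ.Realize (ultrapower U M.toStruc) (pair (ultraTuple U _) (ultraTuple U _))
  rw [ultraTuple_pair, realize_ultrapower]
  exact hxy.mono fun F hF => (hψ M _ _).1 hF

theorem smul_ultraPt {J : Type u} (U : Ultrafilter J) (M : Model T) (Q : DefSet L)
    (x : J → (G.grp (m.idx Q)).pts M) (y z : J → Q.pts M.toStruc)
    (hxy : ∀ᶠ F in (U : Filter J), (m.act Q M).smul (x F) (y F) = z F) :
    (m.act Q (ultraModel U M)).smul (ultraPt U M (X := (G.grp (m.idx Q)).toDefSet) x)
      (ultraPt U M y) = ultraPt U M z := by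
  obtain ⟨ψ, hψ⟩ := m.act_def Q
  refine (hψ _ _ _ _).2 ?_
  change ψ.Realize (ultrapower U M.toStruc)
    (pair (pair (ultraTuple U _) (ultraTuple U _)) (ultraTuple U _))
  rw [ultraTuple_pair, ultraTuple_pair, realize_ultrapower]
  exact hxy.mono fun F hF => (hψ M _ _ _).1 hF

/-- An element of `G(M)` that maps a set of internality parameters into a definably closed set
`B` has its coordinates in `B`. -/
theorem Interp.IsInternalityParams.mem_of_forall_mem {i : Interp T₀ T} (hG : m.IsGalois i)
    {M : Model T} {A B : Subsets M.toStruc} (hA : i.IsInternalityParams M A)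
    {E : G.pts M →* (∀ s, Equiv.Perm (M.carrier s))} (hE : IsGaloisHom i m M E)
    (hB : IsDefClosed M.toStruc B) (hAB : A ≤ B) (g : G.pts M)
    (hg : ∀ s, ∀ a ∈ A s, E g s a ∈ B s) (k : G.I) (j : (G.grp k).ι) :
    (g.1 k).1 j ∈ B ((G.grp k).sort j) := by
  classical
  by_contra hk
  -- The finite pieces of the compactness argument: finitely many conditions `x a = g a`, and
  -- finitely many indices at which the coordinates must be compatible.
  let J := Finset (Σ s, A s) × Finset G.I
  have key : ∀ F : J, ∃ h : ∀ a, (G.grp a).pts M, h k ≠ g.1 k ∧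
      (∀ a ∈ F.2, ∀ b ∈ F.2, ∀ hab : a ≤ b, G.map hab M (h b) = h a) ∧
      ∀ p ∈ F.1, (m.act (sortSet p.1) M).smul (h (m.idx (sortSet p.1)))
        (sortPt M.toStruc p.2.1) = sortPt M.toStruc (E g p.1 p.2.1) := by
    rintro ⟨S, I'⟩
    let I'' := insert k (I' ∪ S.image fun p => m.idx (sortSet p.1))
    obtain ⟨l, hl⟩ := Finset.exists_le I''
    have hkl : k ≤ l := hl k (by simp [I''])
    have hS : ∀ p : S, m.idx (sortSet p.1.1) ≤ l := fun p => hl _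
      (Finset.mem_insert_of_mem (Finset.mem_union_right _ (Finset.mem_image_of_mem
        (fun p : (Σ s, A s) => m.idx (sortSet p.1)) p.2)))
    have hI : ∀ a ∈ I', a ≤ l := fun a ha => hl _
      (Finset.mem_insert_of_mem (Finset.mem_union_left _ ha))
    obtain ⟨x, hx1, hx2⟩ := exists_ne_of_notMem hE hB hAB g hg hk S hkl hS
    -- The value `1` is a mere default: every index constrained at this stage lies below `l`.
    let H : ∀ a, (G.grp a).pts M := fun a => if h : a ≤ l then G.map h M x else 1
    have hH : ∀ a (h : a ≤ l), H a = G.map h M x := fun a h => dif_pos h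
    refine ⟨H, ?_, fun a ha b hb hab => ?_,
      fun p hp => ?_⟩
    · rwa [hH k hkl]
    · rw [hH a (hI a ha), hH b (hI b hb), G.map_comp]
    · rw [hH _ (hS ⟨p, hp⟩)]
      exact hx2 ⟨p, hp⟩
  choose h h1 h2 h3 using key
  -- `U` contains every cone `{F | F₀ ≤ F}`, so each single condition holds for almost all `F`.
  let U : Ultrafilter J := Ultrafilter.of Filter.atTop
  have hU : ∀ F₀ : J, ∀ᶠ F in (U : Filter J), F₀ ≤ F := fun F₀ =>
    Ultrafilter.of_le _ (Filter.eventually_ge_atTop F₀)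
  let N := ultraModel U M
  -- The families `h F` need not be compatible for any single `F`, but their class is a point of the
  -- inverse limit; `g'` is the diagonal image of `g`.
  let h' : G.pts N := ⟨fun a => ultraPt U M (X := (G.grp a).toDefSet) (fun F => h F a),
    fun a b hab => map_ultraPt U M hab _ _ ((hU (∅, {a, b})).mono fun F hF =>
      h2 F a (hF.2 (by simp)) b (hF.2 (by simp)) hab)⟩
  let g' : G.pts N := ⟨fun a => ultraPt U M (X := (G.grp a).toDefSet) (fun _ => g.1 a),
    fun a b hab => map_ultraPt U M hab _ _ (Filter.Eventually.of_forall fun F => g.2 a b hab)⟩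
  obtain ⟨E', hE'⟩ := hG.exists_hom N
  let d : ∀ s, M.carrier s → N.carrier s := fun s b =>
    ((fun _ => b : J → M.carrier s) : Filter.Germ (U : Filter J) (M.carrier s))
  have hh' : ∀ s (a : A s), E' h' s (d s a.1) = d s (E g s a.1) := by
    intro s a
    have e1 := hE'.smul_sortPt h' (d s a.1)
    have e2 := smul_ultraPt (m := m) U M (sortSet s) (fun F => h F (m.idx (sortSet s)))
      (fun _ => sortPt M.toStruc a.1) (fun _ => sortPt M.toStruc (E g s a.1))
      ((hU ({⟨s, a⟩}, ∅)).mono fun F hF => h3 F ⟨s, a⟩ (hF.1 (by simp)))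
    exact congrFun (congrArg Subtype.val (e1.symm.trans e2)) ()
  have hg' : ∀ s (a : A s), E' g' s (d s a.1) = d s (E g s a.1) := by
    intro s a
    have e1 := hE'.smul_sortPt g' (d s a.1)
    have e2 := smul_ultraPt (m := m) U M (sortSet s) (fun F => g.1 (m.idx (sortSet s)))
      (fun _ => sortPt M.toStruc a.1) (fun _ => sortPt M.toStruc (E g s a.1))
      (Filter.Eventually.of_forall fun F => hE.smul_sortPt g a.1)
    exact congrFun (congrArg Subtype.val (e1.symm.trans e2)) ()
  -- Here internality is needed in the elementary extension `N`, not only in `M`.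
  have hd := hA.2 N (fun s a => d s a.1)
    (isElementary_diagonal U M A (f := fun s a => a.1) fun _ _ => Iff.rfl)
  have heq : E' h' = E' g' := by
    funext s
    refine Equiv.ext fun b => ?_
    refine ((hE'.isAut h').isElementary (fun _ => Set.univ)).eq_of_eqOn
      ((hE'.isAut g').isElementary (fun _ => Set.univ)) (fun _ => Set.subset_univ _) ?_
      ⟨b, trivial⟩ (hd s ▸ Set.mem_univ b)
    rintro s ⟨c, hc | ⟨a, rfl⟩⟩
    · exact (hE'.fixes h' s c hc).trans (hE'.fixes g' s c hc).symm
    · exact (hh' s a).trans (hg' s a).symm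
  have h4 := eventually_eq_of_ultraPt_eq U M
    (congrFun (congrArg Subtype.val (hE'.injective heq)) k)
  obtain ⟨F, hF⟩ := h4.exists
  exact h1 F hF

end ManySorted

namespace ManySorted

variable {L₀ L : Lang.{u}} {T₀ : Theory L₀} {T : Theory L}

/-! ### The points of a pro-group in a definably closed set -/

section Points

variable {M : Model T} {B : Subsets M.toStruc}

theorem DefGroup.mul_mem (hB : IsDefClosed M.toStruc B) (H : DefGroup T) {x y : H.pts M}
    (hx : ∀ j, x.1 j ∈ B (H.sort j)) (hy : ∀ j, y.1 j ∈ B (H.sort j)) (j : H.ι) :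
    (x * y).1 j ∈ B (H.sort j) := by
  obtain ⟨μ, hμ⟩ := H.mul_def
  refine hB.mem_of_formula (X := H.toDefSet) (x * y) μ (pair x.1 y.1) ?_ (fun z => ?_) j
  · rintro (k | k)
    · exact hx k
    · exact hy k
  · exact (hμ M x y z).symm.trans eq_comm

theorem DefGroup.one_mem (hB : IsDefClosed M.toStruc B) (H : DefGroup T) (j : H.ι) :
    (1 : H.pts M).1 j ∈ B (H.sort j) := by
  obtain ⟨μ, hμ⟩ := H.mul_def
  refine hB.mem_of_formula (X := H.toDefSet) (1 : H.pts M)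
    (Γ := fun a : Empty => (a.elim : L.Sorts))
    -- The identity is the only solution of `z * z = z`, which needs no parameters.
    (μ.sub (Sub.pair (Sub.pair Sub.snd Sub.snd) Sub.snd)) (fun a => a.elim)
    (fun a => a.elim) (fun z => ?_) j
  simp only [Formula.realize_sub, Sub.eval_pair, Sub.eval_snd]
  have h : ∀ z : H.pts M, z * z = z ↔ z = 1 := fun z => mul_eq_left
  exact (hμ M z z z).symm.trans (h z)

theorem DefGroup.inv_mem (hB : IsDefClosed M.toStruc B) (H : DefGroup T) {x : H.pts M}
    (hx : ∀ j, x.1 j ∈ B (H.sort j)) (j : H.ι) : (x⁻¹).1 j ∈ B (H.sort j) := by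
  obtain ⟨μ, hμ⟩ := H.mul_def
  refine hB.mem_of_formula (X := H.toDefSet) (x⁻¹ : H.pts M)
    (μ.sub (Sub.pair (Sub.pair (Sub.fst.comp Sub.fst) Sub.snd) (Sub.snd.comp Sub.fst)))
    (pair x.1 (1 : H.pts M).1) ?_ (fun z => ?_) j
  · rintro (k | k)
    · exact hx k
    · exact H.one_mem hB k
  simp only [Formula.realize_sub, Sub.eval_pair, Sub.eval_comp, Sub.eval_fst, Sub.eval_snd]
  have h : ∀ z : H.pts M, x * z = 1 ↔ z = x⁻¹ := fun z =>
    mul_eq_one_iff_eq_inv'.trans Iff.rfl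
  exact (hμ M x z (1 : H.pts M)).symm.trans (h z)

/-- The group `G(B)`, for a definably closed set `B`. -/
def ProGroup.ptsIn (G : ProGroup T) (hB : IsDefClosed M.toStruc B) : Subgroup (G.pts M) where
  carrier := {g | ∀ i j, (g.1 i).1 j ∈ B ((G.grp i).sort j)}
  one_mem' i := (G.grp i).one_mem hB
  mul_mem' ha hb i := (G.grp i).mul_mem hB (ha i) (hb i)
  inv_mem' ha i := (G.grp i).inv_mem hB (ha i)

variable {G : ProGroup T} {m : G.Action} {i : Interp T₀ T}
  {E : G.pts M →* (∀ s, Equiv.Perm (M.carrier s))}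

/-- The image of `b` is defined from `b` and a single coordinate of `g`, by the formula for the
action on the sort of `b`. -/
theorem IsGaloisHom.apply_mem (hE : IsGaloisHom i m M E) (hB : IsDefClosed M.toStruc B)
    {g : G.pts M} (hg : g ∈ G.ptsIn hB) {s : L.Sorts} {b : M.carrier s} (hb : b ∈ B s) :
    E g s b ∈ B s := by
  obtain ⟨φ, hφ⟩ := m.act_def (sortSet s)
  refine hB.mem_of_formula (X := sortSet s) (sortPt M.toStruc (E g s b)) φ
    (pair (g.1 (m.idx (sortSet s))).1 (sortPt M.toStruc b).1) ?_ (fun z => ?_) ()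
  · rintro (k | k)
    · exact hg _ k
    · exact hb
  · exact (hφ M _ _ z).symm.trans (by rw [hE.smul_sortPt, eq_comm])

theorem IsGaloisHom.apply_mem_iff (hE : IsGaloisHom i m M E) (hB : IsDefClosed M.toStruc B)
    {g : G.pts M} (hg : g ∈ G.ptsIn hB) {s : L.Sorts} (b : M.carrier s) :
    E g s b ∈ B s ↔ b ∈ B s := by
  refine ⟨fun h => ?_, hE.apply_mem hB hg⟩
  have := hE.apply_mem hB (inv_mem hg) h
  rw [map_inv] at this
  change (E g s)⁻¹ (E g s b) ∈ B s at this
  rwa [show (E g s)⁻¹ (E g s b) = b from (E g s).symm_apply_apply b] at this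

theorem Interp.inj_mono (i : Interp T₀ T) (M : Model T) {C D : Subsets (i.res M).toStruc}
    (h : C ≤ D) : i.inj M C ≤ i.inj M D := by
  rintro s b ⟨s₀, x, hx, hj⟩
  exact ⟨s₀, x, h s₀ hx, hj⟩

/-- The restriction of the action to a definably closed set. -/
def IsGaloisHom.restrict (hE : IsGaloisHom i m M E) (hB : IsDefClosed M.toStruc B)
    (B₀ : Subsets (i.res M).toStruc) :
    G.ptsIn hB →* autGroup M.toStruc B (i.inj M B₀) where
  toFun g := ⟨fun s => (E g.1 s).subtypePerm (hE.apply_mem_iff hB g.2),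
    fun Q x => hE.isAut g.1 Q fun j => (x j).1,
    fun s b hb => Subtype.ext (hE.fixes g.1 s b.1 (i.inj_mono M (fun _ => Set.subset_univ _) s hb))⟩
  map_one' := by
    refine Subtype.ext (funext fun s => Equiv.ext fun b => Subtype.ext ?_)
    change E 1 s b.1 = b.1
    rw [map_one]
    rfl
  map_mul' g g' := by
    refine Subtype.ext (funext fun s => Equiv.ext fun b => Subtype.ext ?_)
    change E (g.1 * g'.1) s b.1 = E g.1 s (E g'.1 s b.1)
    rw [map_mul]
    rfl

end Points

end ManySorted

/-! ### The isomorphism of `G(B)` with `Aut(B/B₀)` -/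

theorem mainTheorem6 {L₀ L : ManySorted.Lang.{u}}
    (T₀ : ManySorted.Theory L₀) (T : ManySorted.Theory L)
    (hEI : T₀.ElimImaginaries)
    (i : ManySorted.Interp T₀ T) (hi : i.IsInternalCover)
    (G : ManySorted.ProGroup T) (m : G.Action) (hG : m.IsGalois i)
    (M : ManySorted.Model T)
    (A : ManySorted.Subsets M.toStruc) (hA : i.IsInternalityParams M A)
    (B₀ : ManySorted.Subsets (i.res M).toStruc)
    (hB₀ : ManySorted.IsDefClosed (i.res M).toStruc B₀)
    (hAB : i.restrict M A ≤ B₀) :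
    m.IdentifiesWithAut M
      (ManySorted.dcl M.toStruc (fun s => A s ∪ i.inj M B₀ s)) (i.inj M B₀) := by
  obtain ⟨E, hE⟩ := hG.exists_hom M
  set C : ManySorted.Subsets M.toStruc := fun s => A s ∪ i.inj M B₀ s
  have hB := ManySorted.isDefClosed_dcl C
  have hCB := ManySorted.subset_dcl C
  have hAC : A ≤ ManySorted.dcl M.toStruc C :=
    fun s => Set.Subset.trans Set.subset_union_left (hCB s)
  refine ⟨G.ptsIn hB, fun g => Iff.rfl, MulEquiv.ofBijective (hE.restrict hB B₀) ⟨?_, ?_⟩,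
    fun g Q x hx j => hE.apply_eq g.1 Q x j⟩
  -- Injectivity: both automorphisms fix `M₀` and agree on `A`, and these generate `M`.
  · intro g g' h
    refine Subtype.ext (hE.injective (funext fun s => Equiv.ext fun b => ?_))
    refine ((hE.isAut g.1).isElementary (fun _ => Set.univ)).eq_of_eqOn
      ((hE.isAut g'.1).isElementary (fun _ => Set.univ)) (fun _ => Set.subset_univ _) ?_
      ⟨b, trivial⟩ (hA.2 M (fun s a => a.1) (fun _ _ => Iff.rfl) s ▸ Set.mem_univ b)
    rintro s ⟨c, hc | ⟨a, rfl⟩⟩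
    · exact (hE.fixes g.1 s c hc).trans (hE.fixes g'.1 s c hc).symm
    · have h1 := congrFun (congrArg Subtype.val h) s
      exact congrArg Subtype.val (Equiv.congr_fun h1 ⟨a.1, hAC s a.2⟩)
  · intro σ
    have hσ := ManySorted.isElementary_of_mem_autGroup σ.2
    -- `σ` fixes `A₀` because `A₀ ⊆ B₀`. The automorphism `τ` is only asked to extend `σ` on `A`;
    -- agreement on all of `B` follows at the end from `B = dcl(A ∪ B₀)`.
    obtain ⟨τ, hτ, hτ₀, hτA⟩ := hA.exists_isAut hi.1 hEI hAC hσ fun s b hb =>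
      congrArg Subtype.val (σ.2.2 s b (i.inj_mono M hAB s hb))
    obtain ⟨g, rfl⟩ := hE.surj τ hτ hτ₀
    -- On `A` the action of `g` is `σ`, which takes values in `B`.
    have hg : g ∈ G.ptsIn hB := fun k j => hA.mem_of_forall_mem hG hE hB hAC g
      (fun s a ha => hτA s a ha ▸ (σ.1 s ⟨a, hAC s ha⟩).2) k j
    refine ⟨⟨g, hg⟩, Subtype.ext (funext fun s => Equiv.ext fun b => Subtype.ext ?_)⟩
    refine (hτ.isElementary (ManySorted.dcl M.toStruc C)).eq_of_eqOn hσ hCB ?_ b b.2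
    rintro s ⟨c, hc | hc⟩
    · exact hτA s c hc
    · exact (hτ₀ s c (i.inj_mono M (fun _ => Set.subset_univ _) s hc)).trans
        (congrArg Subtype.val (σ.2.2 s ⟨c, _⟩ hc)).symm
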